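/- **Theorem (Oracle inequality for CART).** For every $B>0$ there is a constant $C>0$, depending only on $B$, such that the following holds for all integers $n,p\ge 1$ with $np\ge 2$, all $K\ge 1$, and every distribution $\rho$ of a pair $(\mathbf X,Y)$ in $\mathbb R^p\times\mathbb R$ with $|Y|\le B$ almost surely. Let $\mathbb P_{\mathbf X}$ be the law of $\mathbf X=(X_1,\dots,X_p)$, let $\mu(\mathbf X)=\mathbb E(Y\mid \mathbf X)$, let $\|f\|^2=\int |f|^2\,d\mathbb P_{\mathbf X}$, and let $(\mathbf X_1,Y_1),\dots,(\mathbf X_n,Y_n)$ be i.i.d. with law $\rho$. *The tree.* For a node $\mathrm t\subseteq\mathbb R^p$ let $N(\mathrm t)=\#\{i:\mathbf X_i\in\mathrm t\}$, $\overline Y_{\mathrm t}=\frac1{N(\mathrm t)}\sum_{\mathbf X_i\in\mathrm t}Y_i$ and $I(\mathrm t)=\frac1{N(\mathrm t)}\sum_{\mathbf X_i\in\mathrm t}(Y_i-\overline Y_{\mathrm t})^2$. A split $(j,s)$, $1\le j\le p$, $s\in\mathbb R$, divides $\mathrm t$ into $\mathrm t_L=\{\mathbf x\in\mathrm t:x_j\le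 s\}$ and $\mathrm t_R=\{\mathbf x\in\mathrm t:x_j>s\}$; it is a candidate if both daughters contain data points, and its impurity gain is $I(\mathrm t)-\frac{N(\mathrm t_L)}{N(\mathrm t)}I(\mathrm t_L)-\frac{N(\mathrm t_R)}{N(\mathrm t)}I(\mathrm t_R)$. The depth-$K$ CART tree $T_K$ is grown from the root node $\mathbb R^p$ by recursively splitting every node at a candidate split of largest impurity gain, ties being broken arbitrarily; a node is not split if and only if it contains a single data point, or all its responses are equal, or it has no candidate split, or it has depth $K$. The output $\widehat\mu(T_K)$ equals $\overline Y_{\mathrm t}$ on each terminal node $\mathrm t$. *The class $\mathcal G$.* It consists of the functions $g$ with $g(\mathbf X)=g_1(X_1)+\dots+g_p(X_p)$ (almost surely) for some functions $g_j$ of finite total variation $v(g_j)$ over the support of $X_j$; $\|g\|_{\mathrm{TV}}$ is the infimum of $v(g_1)+\dots+v(g_p)$ over all such representations. Then $$ \mathbb E\big(\|\mu-\widehat\mu(T_K)\|^2\big)\ \le\ 2\inf_{g\in\mathcal G}\Big\{\|\mu-g\|^2+\frac{\|g\|_{\mathrm{TV}}^2}{K+3}+C\,\frac{2^K\log(np)}{n}\Big\}.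 $$ The function $\mu$ need not belong to $\mathcal G$, and nothing is assumed about the distribution of $\mathbf X$. (If ties are broken in a nonmeasurable way, the expectation is the upper expectation.) -/

import Mathlib

open MeasureTheory ProbabilityTheory
open scoped ENNReal

noncomputable section

namespace CART

/-! ### Data, nodes, impurity -/

/-- A data set of `n` observations `(X_i, Y_i)` with `X_i ∈ ℝ^p` and `Y_i ∈ ℝ`. -/
abbrev Data (n p : ℕ) := Fin n → (Fin p → ℝ) × ℝ

variable {n p : ℕ}

open Classical in
/-- The indices of the observations whose predictors lie in the node `t`. -/
def nodeIdx (D : Data n p) (t : Set (Fin p → ℝ)) : Finset (Fin n) :=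
  Finset.univ.filter (fun i => (D i).1 ∈ t)

/-- `N(t)`, the number of sample points in the node `t` (with multiplicity). -/
def nodeCount (D : Data n p) (t : Set (Fin p → ℝ)) : ℕ := (nodeIdx D t).card

/-- The sample mean of the responses in the node `t`. -/
def nodeMean (D : Data n p) (t : Set (Fin p → ℝ)) : ℝ :=
  (∑ i ∈ nodeIdx D t, (D i).2) / (nodeCount D t : ℝ)

/-- The impurity of the node `t`: the within node sample variance of the responses. -/
def impurity (D : Data n p) (t : Set (Fin p → ℝ)) : ℝ :=
  (∑ i ∈ nodeIdx D t, ((D i).2 - nodeMean D t) ^ 2) / (nodeCount D t : ℝ)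

/-- The left daughter node of `t` when variable `j` is split at `s`. -/
def leftNode (t : Set (Fin p → ℝ)) (j : Fin p) (s : ℝ) : Set (Fin p → ℝ) :=
  {x | x ∈ t ∧ x j ≤ s}

/-- The right daughter node of `t` when variable `j` is split at `s`. -/
def rightNode (t : Set (Fin p → ℝ)) (j : Fin p) (s : ℝ) : Set (Fin p → ℝ) :=
  {x | x ∈ t ∧ s < x j}

/-- The impurity gain of splitting the node `t` in variable `j` at `s`. -/
def impurityGain (D : Data n p) (t : Set (Fin p → ℝ)) (j : Fin p) (s : ℝ) : ℝ :=
  impurity D t -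
    ((nodeCount D (leftNode t j s) : ℝ) / (nodeCount D t : ℝ) * impurity D (leftNode t j s) +
      (nodeCount D (rightNode t j s) : ℝ) / (nodeCount D t : ℝ) * impurity D (rightNode t j s))

/-- A candidate split: it divides the data of the node `t` into two nonempty parts. -/
def IsSplit (D : Data n p) (t : Set (Fin p → ℝ)) (j : Fin p) (s : ℝ) : Prop :=
  0 < nodeCount D (leftNode t j s) ∧ 0 < nodeCount D (rightNode t j s)

/-- `(j, s)` is a candidate split of the node `t` with the largest impurity gain. Ties are not
resolved: several `(j, s)` may satisfy this. -/
def IsBestSplit (D : Data n p) (t : Set (Fin p → ℝ)) (j : Fin p) (s : ℝ) : Prop :=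
  IsSplit D t j s ∧
    ∀ (j' : Fin p) (s' : ℝ), IsSplit D t j' s' → impurityGain D t j' s' ≤ impurityGain D t j s

/-- The node `t` is not split, whatever its depth: it contains a single data point, or all its
responses are the same, or it has no candidate split (all its predictor vectors coincide). -/
def IsStopped (D : Data n p) (t : Set (Fin p → ℝ)) : Prop :=
  nodeCount D t ≤ 1 ∨
    (∀ i ∈ nodeIdx D t, ∀ i' ∈ nodeIdx D t, (D i).2 = (D i').2) ∨
    ∀ (j : Fin p) (s : ℝ), ¬ IsSplit D t j s

/-! ### Trees -/

/-- Binary trees whose internal nodes are labelled by a split variable and a split point. -/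
inductive Tree (p : ℕ) : Type
  | leaf : Tree p
  | split (j : Fin p) (s : ℝ) (l r : Tree p) : Tree p

/-- `IsCART D K t T`: the tree `T`, rooted at the node `t`, is fully grown to depth `K` by the
CART methodology on the data `D`. -/
def IsCART (D : Data n p) : ℕ → Set (Fin p → ℝ) → Tree p → Prop
  | 0, _, Tree.leaf => True
  | 0, _, Tree.split _ _ _ _ => False
  | _ + 1, t, Tree.leaf => IsStopped D t
  | K + 1, t, Tree.split j s l r =>
      ¬ IsStopped D t ∧ IsBestSplit D t j s ∧
        IsCART D K (leftNode t j s) l ∧ IsCART D K (rightNode t j s) r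

/-- The output at the point `x` of the tree `T` rooted at the node `t`: the sample mean of the
responses in the terminal node that contains `x`. -/
def outputFrom (D : Data n p) : Set (Fin p → ℝ) → Tree p → (Fin p → ℝ) → ℝ
  | t, Tree.leaf, _ => nodeMean D t
  | t, Tree.split j s l r, x =>
      if x j ≤ s then outputFrom D (leftNode t j s) l x
      else outputFrom D (rightNode t j s) r x

/-- `T` is a depth `K` regression tree constructed from the data `D` with the CART methodology,
starting from the root node `ℝ^p`. -/
def IsCARTTree (D : Data n p) (K : ℕ) (T : Tree p) : Prop := IsCART D K Set.univ T

/-- The output of the regression tree `T` with root node `ℝ^p`. -/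
def output (D : Data n p) (T : Tree p) : (Fin p → ℝ) → ℝ := outputFrom D Set.univ T

/-! ### Regression function, norms, additive functions of bounded variation -/

/-- `μ` is (a version of) the regression function `μ(X) = 𝔼(Y | X)` for `(X, Y) ∼ ρ`. -/
def IsRegressionFunction (ρ : Measure ((Fin p → ℝ) × ℝ)) (μ : (Fin p → ℝ) → ℝ) : Prop :=
  Measurable μ ∧
    (fun z : (Fin p → ℝ) × ℝ => μ z.1) =ᵐ[ρ]
      condExp (MeasurableSpace.comap Prod.fst inferInstance) ρ
        (fun z : (Fin p → ℝ) × ℝ => z.2)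

/-- The squared `L_2(ν)` norm. -/
def normSq (ν : Measure (Fin p → ℝ)) (f : (Fin p → ℝ) → ℝ) : ℝ≥0∞ :=
  ∫⁻ x, ENNReal.ofReal (|f x| ^ 2) ∂ν

/-- The support of the `j`-th coordinate of a random vector with law `ν`. -/
def coordSupport (ν : Measure (Fin p → ℝ)) (j : Fin p) : Set ℝ :=
  (ν.map (fun x => x j)).support

/-- `v(h)`: the total variation of `h` over the support of the `j`-th coordinate. -/
def variation (ν : Measure (Fin p → ℝ)) (j : Fin p) (h : ℝ → ℝ) : ℝ≥0∞ :=
  eVariationOn h (coordSupport ν j)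

/-- `g(X) = g_1(X_1) + ⋯ + g_p(X_p)` for `X ∼ ν`, where each `g_j` has bounded variation over the
support of `X_j`. -/
def IsAdditiveRep (ν : Measure (Fin p → ℝ)) (g : (Fin p → ℝ) → ℝ) (gs : Fin p → ℝ → ℝ) : Prop :=
  (∀ j, variation ν j (gs j) < ∞) ∧ ∀ᵐ x ∂ν, g x = ∑ j, gs j (x j)

/-- The class of additive functions with components of bounded variation. -/
def additiveBV (ν : Measure (Fin p → ℝ)) : Set ((Fin p → ℝ) → ℝ) :=
  {g | ∃ gs : Fin p → ℝ → ℝ, IsAdditiveRep ν g gs}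

/-- The norm `‖g‖_TV`: the infimum of `v(g_1) + ⋯ + v(g_p)` over all additive representations. -/
def tvNorm (ν : Measure (Fin p → ℝ)) (g : (Fin p → ℝ) → ℝ) : ℝ≥0∞ :=
  ⨅ (gs : Fin p → ℝ → ℝ) (_ : IsAdditiveRep ν g gs), ∑ j, variation ν j (gs j)

/-! ### Expectation -/

/-- The expectation of a nonnegative function, read as the upper expectation when the function is
not measurable (ties in the tree construction are broken arbitrarily, possibly in a nonmeasurable
way). For measurable functions it is the usual expectation, see `expectation_eq_lintegral`. -/
def expectation {Ω : Type*} [MeasurableSpace Ω] (P : Measure Ω) (f : Ω → ℝ≥0∞) : ℝ≥0∞ :=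
  ⨅ (h : Ω → ℝ≥0∞) (_ : Measurable h) (_ : ∀ᵐ ω ∂P, f ω ≤ h ω), ∫⁻ ω, h ω ∂P

theorem expectation_eq_lintegral {Ω : Type*} [MeasurableSpace Ω] (P : Measure Ω)
    (f : Ω → ℝ≥0∞) (hf : AEMeasurable f P) : expectation P f = ∫⁻ ω, f ω ∂P := by
  apply le_antisymm
  · rw [lintegral_congr_ae hf.ae_eq_mk]
    exact iInf_le_of_le (hf.mk f) (iInf_le_of_le hf.measurable_mk
      (iInf_le_of_le hf.ae_eq_mk.le le_rfl))
  · exact le_iInf fun h => le_iInf fun _ => le_iInf fun hle => lintegral_mono_ae hle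

end CART

end

/-! Fix an additive `g` whose components have total variation at most `V` in sum. The proof bounds
the training error of the tree against that of `g`, then passes from training error to risk.

Training error. In a node with `N` points, the squared sum of the centered responses over the points
beyond a threshold is at most `N²/4` times the gain of that split. If the best gain is `γ`, all such
tail sums are therefore at most `N√γ/2`. Abel summation then bounds the pairing of the centered
responses with `g`, and the excess `R` of the node's residual sum of squares over that of `g` is at
most `N V √γ` (`excess_leaf_le`). A best split lowers the excess by `N γ`, so per data point a
positive excess `r` drops to at most `r - r²/V²`, and iteration gives `V²/(K+3)`. To sum this over
nodes, the quadratic map is replaced by its tangent lines: bounds affine in the excess and in `N`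
add up over daughters, whatever the sign of the excess (`excess_le_affine_succ`,
`exists_excess_le_affine`).

Risk. For bounded `f` the excess loss over `μ` has mean `W = ‖f - μ‖²` and second moment at most `16
B² W`. This self-bounding yields an exponential moment at most `1` for `W/2` minus the excess loss,
hence an error of order `log(card)/n` uniformly over a finite class, at the price of the factor `2`.
The finite class consists of trees whose thresholds lie in nets of approximate quantiles of `ρ` and
whose values lie in a grid; its log-cardinality is of order `2^K log(np)`. Rounding a CART tree into
this class changes it by more than the grid error only on at most `2^K` gaps of mass at most `1/n`,
and the number of sample points in a gap has a bounded exponential moment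
(`exists_deviation_majorant`).

The empirical excess loss of the fixed `g` has expectation exactly `‖μ - g‖²`, so `g` itself need
not be bounded. -/

namespace CART

/-! ### Pairing weights with functions of bounded variation -/

/-- Abel summation: weights with small tail sums pair weakly with functions of small variation. -/
theorem sum_mul_le_tail_mul_variation {ι : Type*} (I : Finset ι) (x w : ι → ℝ) (h : ℝ → ℝ)
    (S : Set ℝ) (hS : ∀ i ∈ I, x i ∈ S) (hv : eVariationOn h S ≠ ∞) (τ : ℝ)
    (hw : ∑ i ∈ I, w i = 0) (hτ : ∀ s, |∑ i ∈ I with s < x i, w i| ≤ τ) :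
    ∑ i ∈ I, w i * h (x i) ≤ τ * (eVariationOn h S).toReal := by
  classical
  have hτ0 : 0 ≤ τ := (abs_nonneg _).trans (hτ 0)
  rcases I.eq_empty_or_nonempty with rfl | hI
  · simp only [Finset.sum_empty]; positivity
  set A := I.image x with hA
  have hAne : A.Nonempty := hI.image x
  obtain ⟨r, hr⟩ : ∃ r, A.card = r + 1 := ⟨A.card - 1, by have := hAne.card_pos; omega⟩
  set e := A.orderEmbOfFin hr with he
  -- The distinct values of `x` in increasing order, continued constantly past the last one so as to
  -- be a monotone sequence on all of `ℕ`.
  set a : ℕ → ℝ := fun k => e ⟨min k r, by omega⟩ with ha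
  have hmono : Monotone a := by
    intro k l hkl
    apply e.monotone
    simp only [Fin.mk_le_mk]; omega
  have hmemA : ∀ k, a k ∈ S := by
    intro k
    have : a k ∈ A := A.orderEmbOfFin_mem hr _
    obtain ⟨i, hi, hix⟩ := Finset.mem_image.1 this
    exact hix ▸ hS i hi
  have hlt : ∀ k m, k < r → m ≤ r → (a k < a m ↔ k < m) := by
    intro k m hk hm
    simp only [ha, e.lt_iff_lt, Fin.mk_lt_mk]; omega
  have hrep : ∀ i ∈ I, h (x i) =
      h (a 0) + ∑ k ∈ Finset.range r, if a k < x i then h (a (k + 1)) - h (a k) else 0 := by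
    intro i hi
    have hxA : x i ∈ Set.range e := by
      rw [he, A.range_orderEmbOfFin hr]; exact Finset.mem_image_of_mem x hi
    obtain ⟨m, hm⟩ := hxA
    have hxm : x i = a m := by
      rw [← hm]; simp only [ha]; congr 1; ext; simp; omega
    rw [hxm, ← Finset.sum_filter]
    have : (Finset.range r).filter (fun k => a k < a m) = Finset.range m := by
      ext k
      simp only [Finset.mem_filter, Finset.mem_range]
      constructor
      · rintro ⟨h1, h2⟩; exact (hlt k m h1 (by omega)).1 h2
      · intro h1; exact ⟨by omega, (hlt k m (by omega) (by omega)).2 h1⟩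
    rw [this, Finset.sum_range_sub (fun k => h (a k))]; ring
  have hsum : ∑ i ∈ I, w i * h (x i) =
      ∑ k ∈ Finset.range r, (h (a (k + 1)) - h (a k)) * ∑ i ∈ I with a k < x i, w i := by
    calc ∑ i ∈ I, w i * h (x i)
        = ∑ i ∈ I, (w i * h (a 0) + ∑ k ∈ Finset.range r,
            (if a k < x i then (h (a (k + 1)) - h (a k)) * w i else 0)) := by
          refine Finset.sum_congr rfl fun i hi => ?_
          rw [hrep i hi, mul_add, Finset.mul_sum]
          congr 1
          refine Finset.sum_congr rfl fun k _ => ?_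
          split_ifs <;> ring
      _ = _ := by
          rw [Finset.sum_add_distrib, ← Finset.sum_mul, hw, zero_mul, zero_add, Finset.sum_comm]
          refine Finset.sum_congr rfl fun k _ => ?_
          rw [Finset.mul_sum, Finset.sum_filter]
  have hvar : ∑ k ∈ Finset.range r, |h (a (k + 1)) - h (a k)| ≤ (eVariationOn h S).toReal := by
    have := eVariationOn.sum_le (f := h) (s := S) (n := r) hmono (fun i => hmemA i)
    rw [← ENNReal.ofReal_le_iff_le_toReal hv, ENNReal.ofReal_sum_of_nonneg
      (fun _ _ => abs_nonneg _)]
    simpa only [edist_dist, Real.dist_eq] using this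
  rw [hsum]
  calc _ ≤ ∑ k ∈ Finset.range r, |h (a (k + 1)) - h (a k)| * τ := by
        refine Finset.sum_le_sum fun k _ => (le_abs_self _).trans ?_
        rw [abs_mul]
        exact mul_le_mul_of_nonneg_left (hτ _) (abs_nonneg _)
    _ ≤ _ := by
        rw [← Finset.sum_mul, mul_comm]
        exact mul_le_mul_of_nonneg_left hvar hτ0

/-! ### Node means, sums of squares and impurity gains -/

variable {n p : ℕ}

theorem mem_nodeIdx {D : Data n p} {t : Set (Fin p → ℝ)} {i : Fin n} :
    i ∈ nodeIdx D t ↔ (D i).1 ∈ t := by simp [nodeIdx]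

theorem nodeIdx_leftNode (D : Data n p) (t : Set (Fin p → ℝ)) (j : Fin p) (s : ℝ) :
    nodeIdx D (leftNode t j s) = (nodeIdx D t).filter (fun i => ¬ s < (D i).1 j) := by
  ext i; simp [mem_nodeIdx, leftNode]

theorem nodeIdx_rightNode (D : Data n p) (t : Set (Fin p → ℝ)) (j : Fin p) (s : ℝ) :
    nodeIdx D (rightNode t j s) = (nodeIdx D t).filter (fun i => s < (D i).1 j) := by
  ext i; simp [mem_nodeIdx, rightNode]

theorem sum_daughters (D : Data n p) (t : Set (Fin p → ℝ)) (j : Fin p) (s : ℝ) (f : Fin n → ℝ) :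
    ∑ i ∈ nodeIdx D (leftNode t j s), f i + ∑ i ∈ nodeIdx D (rightNode t j s), f i =
      ∑ i ∈ nodeIdx D t, f i := by
  rw [nodeIdx_leftNode, nodeIdx_rightNode, add_comm]
  exact Finset.sum_filter_add_sum_filter_not _ _ _

theorem nodeCount_daughters (D : Data n p) (t : Set (Fin p → ℝ)) (j : Fin p) (s : ℝ) :
    (nodeCount D (leftNode t j s) : ℝ) + nodeCount D (rightNode t j s) = nodeCount D t := by
  have := sum_daughters D t j s (fun _ => 1)
  simpa [nodeCount] using this

theorem nodeCount_mul_nodeMean (D : Data n p) (t : Set (Fin p → ℝ)) :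
    (nodeCount D t : ℝ) * nodeMean D t = ∑ i ∈ nodeIdx D t, (D i).2 := by
  rcases Nat.eq_zero_or_pos (nodeCount D t) with h | h
  · have : nodeIdx D t = ∅ := Finset.card_eq_zero.1 h
    simp [h, this]
  · have : (nodeCount D t : ℝ) ≠ 0 := by positivity
    unfold nodeMean; field_simp

theorem sum_sub_nodeMean (D : Data n p) (t : Set (Fin p → ℝ)) :
    ∑ i ∈ nodeIdx D t, ((D i).2 - nodeMean D t) = 0 := by
  rw [Finset.sum_sub_distrib, ← nodeCount_mul_nodeMean]
  simp [nodeCount]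

/-- The sum of squared deviations of the responses in `t` from their mean. -/
noncomputable def nodeSSE (D : Data n p) (t : Set (Fin p → ℝ)) : ℝ :=
  ∑ i ∈ nodeIdx D t, ((D i).2 - nodeMean D t) ^ 2

theorem nodeCount_mul_impurity (D : Data n p) (t : Set (Fin p → ℝ)) :
    (nodeCount D t : ℝ) * impurity D t = nodeSSE D t := by
  rcases Nat.eq_zero_or_pos (nodeCount D t) with h | h
  · have : nodeIdx D t = ∅ := Finset.card_eq_zero.1 h
    simp [h, this, nodeSSE]
  · have : (nodeCount D t : ℝ) ≠ 0 := by positivity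
    unfold impurity nodeSSE; field_simp

theorem nodeCount_pos_of_isSplit {D : Data n p} {t : Set (Fin p → ℝ)} {j : Fin p} {s : ℝ}
    (h : IsSplit D t j s) : 0 < nodeCount D t := by
  have h1 := nodeCount_daughters D t j s
  have h2 := h.1
  have h3 : (nodeCount D (leftNode t j s)) + nodeCount D (rightNode t j s) = nodeCount D t := by
    exact_mod_cast h1
  omega

theorem nodeSSE_sub_eq_mul_impurityGain {D : Data n p} {t : Set (Fin p → ℝ)} {j : Fin p} {s : ℝ}
    (h : IsSplit D t j s) :
    nodeSSE D (leftNode t j s) + nodeSSE D (rightNode t j s) =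
      nodeSSE D t - nodeCount D t * impurityGain D t j s := by
  have hN : (nodeCount D t : ℝ) ≠ 0 := by
    have := nodeCount_pos_of_isSplit h; positivity
  rw [← nodeCount_mul_impurity, ← nodeCount_mul_impurity, ← nodeCount_mul_impurity, impurityGain]
  field_simp
  ring

theorem sum_sq_sub_const (D : Data n p) (t : Set (Fin p → ℝ)) (c : ℝ) :
    ∑ i ∈ nodeIdx D t, ((D i).2 - c) ^ 2 =
      nodeSSE D t + nodeCount D t * (nodeMean D t - c) ^ 2 := by
  have h0 := sum_sub_nodeMean D t
  have : ∀ i ∈ nodeIdx D t, ((D i).2 - c) ^ 2 = ((D i).2 - nodeMean D t) ^ 2 +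
      (2 * (nodeMean D t - c)) * ((D i).2 - nodeMean D t) + (nodeMean D t - c) ^ 2 := by
    intro i _; ring
  rw [Finset.sum_congr rfl this, Finset.sum_add_distrib, Finset.sum_add_distrib, ← Finset.mul_sum,
    h0, Finset.sum_const, nodeSSE, nsmul_eq_mul]
  simp [nodeCount]

/-- The tail sums of the centered responses of a node are controlled by the impurity gain. -/
theorem four_mul_sq_tail_le {D : Data n p} {t : Set (Fin p → ℝ)} {j : Fin p} {s : ℝ}
    (h : IsSplit D t j s) :
    4 * (∑ i ∈ nodeIdx D (rightNode t j s), ((D i).2 - nodeMean D t)) ^ 2 ≤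
      (nodeCount D t : ℝ) ^ 2 * impurityGain D t j s := by
  have hN : (0 : ℝ) < nodeCount D t := by exact_mod_cast nodeCount_pos_of_isSplit h
  have hL : (0 : ℝ) < nodeCount D (leftNode t j s) := by exact_mod_cast h.1
  have hR : (0 : ℝ) < nodeCount D (rightNode t j s) := by exact_mod_cast h.2
  have hLR := nodeCount_daughters D t j s
  have hgain := nodeSSE_sub_eq_mul_impurityGain h
  have e1 := sum_sq_sub_const D (leftNode t j s) (nodeMean D t)
  have e2 := sum_sq_sub_const D (rightNode t j s) (nodeMean D t)
  have e3 := sum_daughters D t j s (fun i => ((D i).2 - nodeMean D t) ^ 2)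
  have e4 := sum_daughters D t j s (fun i => ((D i).2 - nodeMean D t))
  rw [sum_sub_nodeMean] at e4
  have tL : ∑ i ∈ nodeIdx D (leftNode t j s), ((D i).2 - nodeMean D t) =
      nodeCount D (leftNode t j s) * (nodeMean D (leftNode t j s) - nodeMean D t) := by
    rw [Finset.sum_sub_distrib, ← nodeCount_mul_nodeMean]; simp [nodeCount]; ring
  have tR : ∑ i ∈ nodeIdx D (rightNode t j s), ((D i).2 - nodeMean D t) =
      nodeCount D (rightNode t j s) * (nodeMean D (rightNode t j s) - nodeMean D t) := by
    rw [Finset.sum_sub_distrib, ← nodeCount_mul_nodeMean]; simp [nodeCount]; ring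
  rw [tL, tR] at e4
  rw [tR]
  have hg : (nodeCount D t : ℝ) * impurityGain D t j s =
      nodeCount D (leftNode t j s) * (nodeMean D (leftNode t j s) - nodeMean D t) ^ 2 +
      nodeCount D (rightNode t j s) * (nodeMean D (rightNode t j s) - nodeMean D t) ^ 2 := by
    have : nodeSSE D t = ∑ i ∈ nodeIdx D t, ((D i).2 - nodeMean D t) ^ 2 := rfl
    linarith
  rw [pow_two (nodeCount D t : ℝ), mul_assoc, hg]
  generalize nodeMean D (leftNode t j s) - nodeMean D t = a at *
  generalize nodeMean D (rightNode t j s) - nodeMean D t = b at *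
  generalize (nodeCount D (leftNode t j s) : ℝ) = u at *
  generalize (nodeCount D (rightNode t j s) : ℝ) = v at *
  rw [← hLR]
  have hua : u * a = - (v * b) := by linarith
  -- This is `4uv ≤ (u + v)²` in disguise: given `ua = -vb`, the defect is a multiple of a square
  -- that vanishes for balanced splits.
  have key : (u + v) * (u * a ^ 2 + v * b ^ 2) - 4 * (v * b) ^ 2 = u * v * (a + b) ^ 2 := by
    linear_combination (u * a - 3 * v * b) * hua
  have : 0 ≤ u * v * (a + b) ^ 2 := by positivity
  linarith

/-! ### The recursion for the training error -/

/-- The excess of the residual sum of squares of the tree `T` over the one of the function `G`,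
on the data in the node `t`. -/
noncomputable def excess (D : Data n p) (G : (Fin p → ℝ) → ℝ) (t : Set (Fin p → ℝ)) (T : Tree p) :
    ℝ :=
  ∑ i ∈ nodeIdx D t, (((D i).2 - outputFrom D t T (D i).1) ^ 2 - ((D i).2 - G (D i).1) ^ 2)

theorem excess_leaf (D : Data n p) (G : (Fin p → ℝ) → ℝ) (t : Set (Fin p → ℝ)) :
    excess D G t Tree.leaf =
      nodeSSE D t - ∑ i ∈ nodeIdx D t, ((D i).2 - G (D i).1) ^ 2 := by
  simp [excess, outputFrom, nodeSSE]

theorem excess_split (D : Data n p) (G : (Fin p → ℝ) → ℝ) (t : Set (Fin p → ℝ)) (j : Fin p)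
    (s : ℝ) (l r : Tree p) :
    excess D G t (Tree.split j s l r) =
      excess D G (leftNode t j s) l + excess D G (rightNode t j s) r := by
  rw [excess, ← sum_daughters D t j s]
  congr 1
  · refine Finset.sum_congr rfl fun i hi => ?_
    have : (D i).1 j ≤ s := (mem_nodeIdx.1 hi).2
    simp [outputFrom, this]
  · refine Finset.sum_congr rfl fun i hi => ?_
    have : ¬ (D i).1 j ≤ s := not_le.2 (mem_nodeIdx.1 hi).2
    simp [outputFrom, this]

/-- The residuals of `G` are the same before and after the split, so the drop in the sum of squares
is also the drop in the excess. -/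
theorem excess_leaf_daughters {D : Data n p} {t : Set (Fin p → ℝ)} {j : Fin p} {s : ℝ}
    (h : IsSplit D t j s) (G : (Fin p → ℝ) → ℝ) :
    excess D G (leftNode t j s) Tree.leaf + excess D G (rightNode t j s) Tree.leaf =
      excess D G t Tree.leaf - nodeCount D t * impurityGain D t j s := by
  have h1 := nodeSSE_sub_eq_mul_impurityGain h
  have h2 := sum_daughters D t j s (fun i => ((D i).2 - G (D i).1) ^ 2)
  simp only [excess_leaf]
  linarith

/-- Expand around the node mean: constants are orthogonal to the centered responses, and the square
of `G` minus the mean is dropped. -/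
theorem excess_leaf_le_inner (D : Data n p) (G : (Fin p → ℝ) → ℝ) (t : Set (Fin p → ℝ)) :
    excess D G t Tree.leaf ≤
      2 * ∑ i ∈ nodeIdx D t, ((D i).2 - nodeMean D t) * G (D i).1 := by
  have h0 := sum_sub_nodeMean D t
  have : excess D G t Tree.leaf =
      ∑ i ∈ nodeIdx D t, (2 * (((D i).2 - nodeMean D t) * G (D i).1) +
        (-2 * nodeMean D t) * ((D i).2 - nodeMean D t) - (G (D i).1 - nodeMean D t) ^ 2) := by
    refine Finset.sum_congr rfl fun i _ => ?_
    simp only [outputFrom]; ring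
  rw [this, Finset.sum_sub_distrib, Finset.sum_add_distrib, ← Finset.mul_sum, ← Finset.mul_sum, h0]
  have : 0 ≤ ∑ i ∈ nodeIdx D t, (G (D i).1 - nodeMean D t) ^ 2 :=
    Finset.sum_nonneg fun i _ => sq_nonneg _
  linarith

/-- If no candidate split gains more than `γ`, then a single leaf is at most `V √γ` worse than an
additive function of total variation `V`. -/
theorem excess_leaf_le {D : Data n p} {t : Set (Fin p → ℝ)} {gs : Fin p → ℝ → ℝ}
    {S : Fin p → Set ℝ} {V γ : ℝ} (hS : ∀ i j, (D i).1 j ∈ S j)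
    (hfin : ∀ j, eVariationOn (gs j) (S j) ≠ ∞)
    (hV : ∑ j, (eVariationOn (gs j) (S j)).toReal ≤ V) (hγ0 : 0 ≤ γ)
    (hγ : ∀ j s, IsSplit D t j s → impurityGain D t j s ≤ γ) :
    excess D (fun x => ∑ j, gs j (x j)) t Tree.leaf ≤ nodeCount D t * (V * √γ) := by
  refine (excess_leaf_le_inner D _ t).trans ?_
  have hN : (0 : ℝ) ≤ nodeCount D t := by positivity
  set τ := (nodeCount D t : ℝ) * √γ / 2 with hτ
  have hτ0 : 0 ≤ τ := by positivity
  have tail : ∀ j s, |∑ i ∈ nodeIdx D t with s < (D i).1 j, ((D i).2 - nodeMean D t)| ≤ τ := by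
    intro j s
    rw [← nodeIdx_rightNode]
    by_cases h : IsSplit D t j s
    · refine abs_le_of_sq_le_sq ?_ hτ0
      have h1 := four_mul_sq_tail_le h
      have h2 := mul_le_mul_of_nonneg_left (hγ j s h) (sq_nonneg (nodeCount D t : ℝ))
      have h3 : τ ^ 2 = (nodeCount D t : ℝ) ^ 2 * γ / 4 := by
        rw [hτ, div_pow, mul_pow, Real.sq_sqrt hγ0]; norm_num
      rw [h3]; linarith
    -- A threshold that is not a candidate leaves one side empty; the tail is then empty or the full
    -- centered sum, and vanishes either way.
    · have h0 := sum_daughters D t j s (fun i => ((D i).2 - nodeMean D t))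
      rw [sum_sub_nodeMean] at h0
      have : ∑ i ∈ nodeIdx D (rightNode t j s), ((D i).2 - nodeMean D t) = 0 := by
        rw [IsSplit, not_and_or, not_lt, not_lt, Nat.le_zero, Nat.le_zero] at h
        rcases h with h | h
        · rw [Finset.card_eq_zero.1 h, Finset.sum_empty, zero_add] at h0; exact h0
        · rw [Finset.card_eq_zero.1 h, Finset.sum_empty]
      rw [this, abs_zero]; exact hτ0
  have main : ∑ i ∈ nodeIdx D t, ((D i).2 - nodeMean D t) * ∑ j, gs j ((D i).1 j) ≤ τ * V := by
    simp only [Finset.mul_sum]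
    rw [Finset.sum_comm]
    calc _ ≤ ∑ j, τ * (eVariationOn (gs j) (S j)).toReal :=
          Finset.sum_le_sum fun j _ => sum_mul_le_tail_mul_variation (nodeIdx D t)
            (fun i => (D i).1 j) (fun i => (D i).2 - nodeMean D t) (gs j) (S j)
            (fun i _ => hS i j) (hfin j) τ (sum_sub_nodeMean D t) (tail j)
      _ ≤ _ := by rw [← Finset.mul_sum]; exact mul_le_mul_of_nonneg_left hV hτ0
  calc _ ≤ 2 * (τ * V) := by linarith
    _ = _ := by rw [hτ]; ring

/-- Early stopping is harmless: equal responses are fitted exactly, and without candidate splits the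
bound `N V √γ` applies with `γ = 0`. -/
theorem excess_leaf_nonpos_of_isStopped {D : Data n p} {t : Set (Fin p → ℝ)}
    {gs : Fin p → ℝ → ℝ} {S : Fin p → Set ℝ} (hS : ∀ i j, (D i).1 j ∈ S j)
    (hfin : ∀ j, eVariationOn (gs j) (S j) ≠ ∞) (h : IsStopped D t) :
    excess D (fun x => ∑ j, gs j (x j)) t Tree.leaf ≤ 0 := by
  have hconst : (∀ i ∈ nodeIdx D t, ∀ i' ∈ nodeIdx D t, (D i).2 = (D i').2) →
      excess D (fun x => ∑ j, gs j (x j)) t Tree.leaf ≤ 0 := by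
    intro hc
    rw [excess_leaf]
    have hz : nodeSSE D t = 0 := by
      refine Finset.sum_eq_zero fun i hi => ?_
      have h1 := nodeCount_mul_nodeMean D t
      rw [Finset.sum_congr rfl (fun i' hi' => hc i' hi' i hi), Finset.sum_const, nsmul_eq_mul] at h1
      have h2 : (nodeCount D t : ℝ) ≠ 0 := by
        have : 0 < nodeCount D t := Finset.card_pos.2 ⟨i, hi⟩
        positivity
      have h3 : nodeMean D t = (D i).2 := mul_left_cancel₀ h2 h1
      rw [h3]; ring
    have : 0 ≤ ∑ i ∈ nodeIdx D t, ((D i).2 - ∑ j, gs j ((D i).1 j)) ^ 2 :=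
      Finset.sum_nonneg fun i _ => sq_nonneg _
    rw [hz]; linarith
  rcases h with h | h | h
  · exact hconst fun i hi i' hi' => by rw [Finset.card_le_one.1 h i hi i' hi']
  · exact hconst h
  · have := excess_leaf_le (t := t) (γ := 0) hS hfin le_rfl le_rfl
      (fun j s hs => (h j s hs).elim)
    simpa using this

/-- One more level of splitting, with `r - r²/V²` replaced by its tangent at `r = V² a`. The slope
is `1 - 2a` and the intercept `V² a²`; the parameter `a` is free and is chosen later for each level.
-/
theorem excess_le_affine_succ {D : Data n p} {gs : Fin p → ℝ → ℝ}
    {S : Fin p → Set ℝ} {V : ℝ} (hS : ∀ i j, (D i).1 j ∈ S j)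
    (hfin : ∀ j, eVariationOn (gs j) (S j) ≠ ∞)
    (hV : ∑ j, (eVariationOn (gs j) (S j)).toReal ≤ V) (α β a : ℝ) (hα : 0 ≤ α) (hα1 : α ≤ 1)
    (hβ : 0 ≤ β) (ha0 : 0 ≤ a) (K : ℕ)
    (ih : ∀ t T, IsCART D K t T → excess D (fun x => ∑ j, gs j (x j)) t T ≤
      α * excess D (fun x => ∑ j, gs j (x j)) t Tree.leaf + β * nodeCount D t)
    (t : Set (Fin p → ℝ)) (T : Tree p) (hT : IsCART D (K + 1) t T) :
    excess D (fun x => ∑ j, gs j (x j)) t T ≤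
      (α * (1 - 2 * a)) * excess D (fun x => ∑ j, gs j (x j)) t Tree.leaf +
        (α * (V ^ 2 * a ^ 2) + β) * nodeCount D t := by
  have hN : (0 : ℝ) ≤ nodeCount D t := by positivity
  cases T with
  | leaf =>
    have h0 := excess_leaf_nonpos_of_isStopped hS hfin hT
    -- A stopped node has nonpositive excess, so multiplying it by a factor at most `1` only
    -- increases it.
    have h1 : α * (1 - 2 * a) ≤ 1 := by nlinarith
    have h2 : 0 ≤ (α * (V ^ 2 * a ^ 2) + β) * (nodeCount D t : ℝ) := by positivity
    nlinarith
  | split j s l r =>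
    obtain ⟨-, hbest, hl, hr⟩ := hT
    have hNpos : (0 : ℝ) < nodeCount D t := by
      exact_mod_cast nodeCount_pos_of_isSplit hbest.1
    have hγ0 : 0 ≤ impurityGain D t j s := by
      have := four_mul_sq_tail_le hbest.1
      by_contra hneg
      have h3 : (nodeCount D t : ℝ) ^ 2 * impurityGain D t j s < 0 :=
        mul_neg_of_pos_of_neg (by positivity) (not_le.1 hneg)
      nlinarith [sq_nonneg (∑ i ∈ nodeIdx D (rightNode t j s), ((D i).2 - nodeMean D t))]
    have hle := excess_leaf_le (t := t) (γ := impurityGain D t j s) hS hfin hV hγ0 hbest.2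
    have h1 := ih _ _ hl
    have h2 := ih _ _ hr
    have h3 := excess_leaf_daughters hbest.1 (fun x => ∑ j, gs j (x j))
    have h4 := nodeCount_daughters D t j s
    rw [excess_split]
    set R := excess D (fun x => ∑ j, gs j (x j)) t Tree.leaf
    set N : ℝ := (nodeCount D t : ℝ)
    set q := √(impurityGain D t j s) with hq
    have hq2 : q ^ 2 = impurityGain D t j s := Real.sq_sqrt hγ0
    have hsum : excess D (fun x => ∑ j, gs j (x j)) (leftNode t j s) l +
        excess D (fun x => ∑ j, gs j (x j)) (rightNode t j s) r ≤
        α * (R - N * q ^ 2) + β * N := by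
      rw [hq2, ← h3, ← h4]; linarith
    -- Use `q² ≥ 2 a V q - V² a²`, then `R ≤ N V q`.
    have hkey : R - N * q ^ 2 ≤ (1 - 2 * a) * R + V ^ 2 * a ^ 2 * N := by
      have e1 : 2 * a * R ≤ 2 * a * (N * (V * q)) := mul_le_mul_of_nonneg_left hle (by positivity)
      have e2 : 0 ≤ N * (q - V * a) ^ 2 := by positivity
      nlinarith
    have := mul_le_mul_of_nonneg_left hkey hα
    calc _ ≤ α * (R - N * q ^ 2) + β * N := hsum
      _ ≤ α * ((1 - 2 * a) * R + V ^ 2 * a ^ 2 * N) + β * N := by linarith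
      _ = _ := by ring

/-- The parameter `d` counts the levels above: a node there is expected to have excess `V²/(d+4)`
per point, and the affine bound is required to be good only at that value. Each level uses the
tangent there, `a = 1/(d+4)`, and hands the value `V²/(d+5)` to the next. -/
theorem exists_excess_le_affine {D : Data n p} {gs : Fin p → ℝ → ℝ}
    {S : Fin p → Set ℝ} {V : ℝ} (hS : ∀ i j, (D i).1 j ∈ S j)
    (hfin : ∀ j, eVariationOn (gs j) (S j) ≠ ∞)
    (hV : ∑ j, (eVariationOn (gs j) (S j)).toReal ≤ V) (K : ℕ) : ∀ d : ℕ,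
    ∃ α β : ℝ, 0 ≤ α ∧ α ≤ 1 ∧ 0 ≤ β ∧ α * (V ^ 2 / (d + 4)) + β ≤ V ^ 2 / (K + d + 4) ∧
      ∀ t T, IsCART D K t T → excess D (fun x => ∑ j, gs j (x j)) t T ≤
        α * excess D (fun x => ∑ j, gs j (x j)) t Tree.leaf + β * nodeCount D t := by
  induction K with
  | zero =>
    intro d
    refine ⟨1, 0, zero_le_one, le_rfl, le_rfl, by simp, fun t T hT => ?_⟩
    cases T with
    | leaf => simp
    | split j s l r => exact hT.elim
  | succ K ih =>
    intro d
    obtain ⟨α, β, hα, hα1, hβ, hle, hbd⟩ := ih (d + 1)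
    have hd : (0 : ℝ) < d + 4 := by positivity
    have ha : 2 * (1 / ((d : ℝ) + 4)) ≤ 1 := by
      rw [mul_one_div, div_le_one hd]; linarith [(Nat.cast_nonneg d : (0 : ℝ) ≤ d)]
    have ha0 : (0 : ℝ) ≤ 1 / ((d : ℝ) + 4) := by positivity
    refine ⟨α * (1 - 2 * (1 / ((d : ℝ) + 4))), α * (V ^ 2 * (1 / ((d : ℝ) + 4)) ^ 2) + β,
      mul_nonneg hα (by linarith), by nlinarith, by positivity, ?_,
      excess_le_affine_succ hS hfin hV α β _ hα hα1 hβ ha0 K hbd⟩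
    push_cast at hle ⊢
    -- The tangent takes the value `V² (d+3)/(d+4)²` at its base point, and `(d+3)(d+5) ≤ (d+4)²`.
    have h1 : V ^ 2 * ((1 - 2 * (1 / ((d : ℝ) + 4))) / (d + 4) + (1 / ((d : ℝ) + 4)) ^ 2) ≤
        V ^ 2 * (1 / (d + 1 + 4)) := by
      refine mul_le_mul_of_nonneg_left ?_ (sq_nonneg V)
      have e : (1 - 2 * (1 / ((d : ℝ) + 4))) / (d + 4) + (1 / ((d : ℝ) + 4)) ^ 2 =
          (d + 3) / ((d + 4) ^ 2) := by field_simp; ring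
      rw [e, div_le_div_iff₀ (by positivity) (by positivity)]
      nlinarith [(Nat.cast_nonneg d : (0 : ℝ) ≤ d)]
    have h2 := mul_le_mul_of_nonneg_left h1 hα
    have h3 : V ^ 2 / ((K : ℝ) + (d + 1) + 4) = V ^ 2 / (K + 1 + d + 4) := by ring_nf
    rw [h3] at hle
    calc _ = α * (V ^ 2 * ((1 - 2 * (1 / ((d : ℝ) + 4))) / (d + 4) +
          (1 / ((d : ℝ) + 4)) ^ 2)) + β := by ring
      _ ≤ α * (V ^ 2 * (1 / (d + 1 + 4))) + β := by linarith
      _ = α * (V ^ 2 / (d + 1 + 4)) + β := by ring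
      _ ≤ _ := hle

/-- The training error bound for CART. -/
theorem trainingError_le {D : Data n p} {gs : Fin p → ℝ → ℝ}
    {S : Fin p → Set ℝ} {V : ℝ} (hS : ∀ i j, (D i).1 j ∈ S j)
    (hfin : ∀ j, eVariationOn (gs j) (S j) ≠ ∞)
    (hV : ∑ j, (eVariationOn (gs j) (S j)).toReal ≤ V) {K : ℕ} (hK : 1 ≤ K) {T : Tree p}
    (hT : IsCARTTree D K T) :
    ∑ i, ((D i).2 - output D T (D i).1) ^ 2 ≤
      ∑ i, ((D i).2 - ∑ j, gs j ((D i).1 j)) ^ 2 + n * (V ^ 2 / (K + 3)) := by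
  obtain ⟨k, rfl⟩ : ∃ k, K = k + 1 := ⟨K - 1, by omega⟩
  obtain ⟨α, β, hα, hα1, hβ, hle, hbd⟩ := exists_excess_le_affine hS hfin hV k 0
  -- At the root, `a = 1/2` makes the slope zero: the initial excess disappears and the daughters
  -- start from `V²/4`, the case `d = 0`.
  have := excess_le_affine_succ hS hfin hV α β (1 / 2) hα hα1 hβ (by norm_num)
    k hbd Set.univ T hT
  have hidx : nodeIdx D Set.univ = Finset.univ := by ext; simp [mem_nodeIdx]
  have hcount : nodeCount D Set.univ = n := by simp [nodeCount, hidx]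
  rw [hcount, excess, hidx, Finset.sum_sub_distrib] at this
  norm_num at this hle ⊢
  have h2 : (α * (V ^ 2 / 4) + β) * n ≤ (V ^ 2 / (k + 4)) * n :=
    mul_le_mul_of_nonneg_right hle (by positivity)
  have h3 : V ^ 2 / ((k : ℝ) + 1 + 3) = V ^ 2 / (k + 4) := by ring_nf
  rw [h3, mul_comm (n : ℝ)]
  unfold output
  linarith

/-! ### Discretization of thresholds and values -/

/-- Every probability measure on the line has a net of `n + 1` thresholds such that each threshold
is equivalent to one of the net, up to a set of measure `1 / n` that depends on the latter only. -/
theorem exists_threshold_net (ν : Measure ℝ) [IsProbabilityMeasure ν] {n : ℕ} (hn : 0 < n) :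
    ∃ (rep : Fin (n + 1) → ℝ) (A : Fin (n + 1) → Set ℝ),
      (∀ k, MeasurableSet (A k)) ∧ (∀ k, ν.real (A k) ≤ 1 / n) ∧
      ∀ s, ∃ k, ∀ x, x ∉ A k → (x ≤ s ↔ x ≤ rep k) := by
  classical
  have hn0 : (0 : ℝ) < n := by exact_mod_cast hn
  set F : ℝ → ℝ := fun s => ν.real (Set.Iic s) with hF
  have hFmono : Monotone F := fun a b hab => measureReal_mono (Set.Iic_subset_Iic.2 hab)
  have hF1 : ∀ s, F s ≤ 1 := fun s => measureReal_le_one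
  have hF0 : ∀ s, 0 ≤ F s := fun s => measureReal_nonneg
  -- Thresholds are grouped by the level of the distribution function, in steps of `1/n`; level `n`
  -- is attained where it equals `1`, hence `n + 1` classes.
  set lev : ℝ → ℕ := fun s => ⌊n * F s⌋₊ with hlev
  have hlevmono : Monotone lev := fun a b hab =>
    Nat.floor_mono (mul_le_mul_of_nonneg_left (hFmono hab) hn0.le)
  have hlevlt : ∀ s, lev s < n + 1 := by
    intro s
    rw [hlev, Nat.floor_lt (by have := hF0 s; positivity)]
    push_cast
    nlinarith [hF1 s]
  have hIoc : ∀ s s', s ≤ s' → lev s = lev s' → ν.real (Set.Ioc s s') ≤ 1 / n := by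
    intro s s' hs hl
    have h1 : ν.real (Set.Ioc s s') = F s' - F s := by
      have e : Set.Ioc s s' = Set.Iic s' \ Set.Iic s := by ext x; simp [and_comm]
      rw [e, measureReal_sdiff (Set.Iic_subset_Iic.2 hs) measurableSet_Iic]
    have h2 : n * F s' < lev s' + 1 := Nat.lt_floor_add_one _
    have h3 : (lev s : ℝ) ≤ n * F s := Nat.floor_le (by have := hF0 s; positivity)
    rw [h1, le_div_iff₀ hn0]
    rw [hl] at h3
    nlinarith
  set rep : Fin (n + 1) → ℝ := fun k => if h : ∃ s, lev s = k then h.choose else 0 with hrep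
  have hrepl : ∀ s, lev (rep ⟨lev s, hlevlt s⟩) = lev s := by
    intro s
    have h : ∃ s', lev s' = lev s := ⟨s, rfl⟩
    simp only [hrep, h, dif_pos]
    exact h.choose_spec
  -- The least point of a level, if there is one, is left out: it may be a large atom, but it lies
  -- to the left of or at every threshold of its level.
  set A : Fin (n + 1) → Set ℝ := fun k => {x | lev x = k ∧ ∃ s, lev s = k ∧ s < x} with hA
  have hAord : ∀ k, (A k).OrdConnected := by
    intro k
    refine ⟨fun x hx y hy z hz => ?_⟩
    obtain ⟨hx1, s, hs, hsx⟩ := hx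
    have hzl : lev z = k :=
      le_antisymm (hy.1 ▸ hlevmono hz.2) (hx1 ▸ hlevmono hz.1)
    exact ⟨hzl, s, hs, hsx.trans_le hz.1⟩
  refine ⟨rep, A, fun k => (hAord k).measurableSet, fun k => ?_, fun s => ⟨⟨lev s, hlevlt s⟩, ?_⟩⟩
  · have : ν (A k) ≤ ENNReal.ofReal (1 / n) := by
      -- A compact subset has a least and a greatest point, so it fits into one interval `(s, b]`
      -- within the level, whether or not the level has a least point.
      rw [(hAord k).measurableSet.measure_eq_iSup_isCompact]
      refine iSup₂_le fun Q hQA => iSup_le fun hQ => ?_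
      rcases Q.eq_empty_or_nonempty with rfl | hne
      · simp
      obtain ⟨a, haQ, ha⟩ := hQ.exists_isLeast hne
      obtain ⟨b, hbQ, hb⟩ := hQ.exists_isGreatest hne
      obtain ⟨-, s, hs, hsa⟩ := hQA haQ
      have hsub : Q ⊆ Set.Ioc s b := fun x hx => ⟨hsa.trans_le (ha hx), hb hx⟩
      refine (measure_mono hsub).trans ?_
      rw [← ofReal_measureReal]
      exact ENNReal.ofReal_le_ofReal
        (hIoc s b (hsa.le.trans (ha hbQ)) (hs.trans (hQA hbQ).1.symm))
    exact ENNReal.toReal_le_of_le_ofReal (by positivity) this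
  · intro x hx
    by_contra hne
    apply hx
    have hr := hrepl s
    generalize rep ⟨lev s, hlevlt s⟩ = s' at hr hne
    have : (s' < x ∧ x ≤ s) ∨ (s < x ∧ x ≤ s') := by
      by_cases h1 : x ≤ s
      · exact Or.inl ⟨not_le.1 fun h => hne ⟨fun _ => h, fun _ => h1⟩, h1⟩
      · refine Or.inr ⟨not_le.1 h1, ?_⟩
        by_contra h2
        exact hne ⟨fun h => (h1 h).elim, fun h => (h2 h).elim⟩
    rcases this with ⟨h1, h2⟩ | ⟨h1, h2⟩
    · exact ⟨le_antisymm (hlevmono h2) (hr.symm.le.trans (hlevmono h1.le)), s', hr, h1⟩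
    · exact ⟨le_antisymm ((hlevmono h2).trans hr.le) (hlevmono h1.le), s, rfl, h1⟩

/-- Every point of `[-B, B]` is within `B / n` of one of `2 n + 1` grid points. -/
theorem exists_grid_near {B v : ℝ} (hB : 0 < B) {n : ℕ} (hn : 0 < n) (hv : |v| ≤ B) :
    ∃ m : Fin (2 * n + 1), |(-B + m * (B / n)) - v| ≤ B / n := by
  have hn0 : (0 : ℝ) < n := by exact_mod_cast hn
  obtain ⟨h1, h2⟩ := abs_le.1 hv
  set y := (v + B) * (n / B) with hy
  have hy0 : 0 ≤ y := mul_nonneg (by linarith) (by positivity)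
  have hy2 : y < (2 * n + 1 : ℕ) := by
    have : y ≤ (2 * B) * (n / B) := mul_le_mul_of_nonneg_right (by linarith) (by positivity)
    have e : (2 * B) * (n / B) = 2 * n := by field_simp
    push_cast; linarith
  have hv' : v = -B + y * (B / n) := by rw [hy]; field_simp; ring
  refine ⟨⟨⌊y⌋₊, (Nat.floor_lt hy0).2 hy2⟩, ?_⟩
  have f1 := Nat.floor_le hy0
  have f2 := Nat.lt_floor_add_one y
  have e : (-B + (⌊y⌋₊ : ℝ) * (B / n)) - v = -((y - ⌊y⌋₊) * (B / n)) := by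
    rw [hv']; ring
  rw [e, abs_neg, abs_of_nonneg (mul_nonneg (by linarith) (by positivity))]
  exact mul_le_of_le_one_left (by positivity) (by linarith)

theorem abs_grid_le {B : ℝ} (hB : 0 < B) {n : ℕ} (hn : 0 < n) (m : Fin (2 * n + 1)) :
    |-B + m * (B / n)| ≤ B := by
  have hn0 : (0 : ℝ) < n := by exact_mod_cast hn
  have h1 : (0 : ℝ) ≤ m * (B / n) := by positivity
  have h2 : (m : ℝ) * (B / n) ≤ 2 * B := by
    have : (m : ℝ) ≤ 2 * n := by
      have := m.is_lt
      exact_mod_cast (by omega : (m : ℕ) ≤ 2 * n)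
    calc (m : ℝ) * (B / n) ≤ 2 * n * (B / n) := mul_le_mul_of_nonneg_right this (by positivity)
      _ = 2 * B := by field_simp
  rw [abs_le]; constructor <;> linarith

/-! ### The finite class of trees -/

open Classical in
/-- The finite class of the functions given by trees of depth at most `K`, with the thresholds
`rep j k` and the terminal values `val m`. -/
noncomputable def treeClass {κ ν : Type*} [Fintype κ] [Fintype ν] (rep : Fin p → κ → ℝ)
    (val : ν → ℝ) : ℕ → Finset ((Fin p → ℝ) → ℝ)
  | 0 => Finset.univ.image fun m _ => val m
  | K + 1 => (Finset.univ.image fun m _ => val m) ∪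
      ((Finset.univ ×ˢ Finset.univ) ×ˢ (treeClass rep val K ×ˢ treeClass rep val K)).image
        fun q x => if x q.1.1 ≤ rep q.1.1 q.1.2 then q.2.1 x else q.2.2 x

section treeClass

open scoped Classical

variable {κ ν : Type*} [Fintype κ] [Fintype ν] {rep : Fin p → κ → ℝ} {val : ν → ℝ}

theorem const_mem_treeClass (K : ℕ) (m : ν) : (fun _ => val m) ∈ treeClass rep val K := by
  cases K <;> simp [treeClass]

theorem ite_mem_treeClass {K : ℕ} {f g : (Fin p → ℝ) → ℝ} (hf : f ∈ treeClass rep val K)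
    (hg : g ∈ treeClass rep val K) (j : Fin p) (k : κ) :
    (fun x => if x j ≤ rep j k then f x else g x) ∈ treeClass rep val (K + 1) := by
  rw [treeClass, Finset.mem_union]
  exact Or.inr (Finset.mem_image.2 ⟨((j, k), (f, g)), by simp [hf, hg], rfl⟩)

theorem treeClass_induction {P : ((Fin p → ℝ) → ℝ) → Prop} (hc : ∀ m, P fun _ => val m)
    (hs : ∀ f g j k, P f → P g → P fun x => if x j ≤ rep j k then f x else g x) (K : ℕ) :
    ∀ f ∈ treeClass rep val K, P f := by
  induction K with
  | zero =>
    intro f hf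
    obtain ⟨m, -, rfl⟩ := Finset.mem_image.1 hf
    exact hc m
  | succ K ih =>
    intro f hf
    rcases Finset.mem_union.1 hf with hf | hf
    · obtain ⟨m, -, rfl⟩ := Finset.mem_image.1 hf
      exact hc m
    · obtain ⟨⟨⟨j, k⟩, f, g⟩, hq, rfl⟩ := Finset.mem_image.1 hf
      simp only [Finset.mem_product, Finset.mem_univ, true_and] at hq
      exact hs f g j k (ih f hq.1) (ih g hq.2)

theorem measurable_of_mem_treeClass {K : ℕ} {f : (Fin p → ℝ) → ℝ} (hf : f ∈ treeClass rep val K) :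
    Measurable f :=
  treeClass_induction (rep := rep) (val := val) (P := Measurable) (fun _ => measurable_const)
    (fun _ _ j _ hf hg => Measurable.ite
      (measurableSet_le (measurable_pi_apply j) measurable_const) hf hg) K f hf

theorem abs_le_of_mem_treeClass {B : ℝ} (hval : ∀ m, |val m| ≤ B) {K : ℕ} {f : (Fin p → ℝ) → ℝ}
    (hf : f ∈ treeClass rep val K) (x : Fin p → ℝ) : |f x| ≤ B :=
  treeClass_induction (rep := rep) (val := val) (P := fun f => ∀ x, |f x| ≤ B) (fun m _ => hval m)
    (fun f g j k hf hg x => by dsimp only; split_ifs; exacts [hf x, hg x]) K f hf x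

/-- The cardinalities satisfy `a_{K+1} ≤ M a_K²`; the extra factor `2 M` turns this into plain
squaring. -/
theorem card_treeClass_le (K : ℕ) :
    (treeClass rep val K).card * (2 * (Fintype.card ν + p * Fintype.card κ)) ≤
      (2 * (Fintype.card ν + p * Fintype.card κ)) ^ 2 ^ (K + 1) := by
  set M := Fintype.card ν + p * Fintype.card κ with hM
  have hc : (Finset.univ.image fun (m : ν) (_ : Fin p → ℝ) => val m).card ≤ Fintype.card ν :=
    Finset.card_image_le
  induction K with
  | zero =>
    have : (treeClass rep val 0).card ≤ 2 * M := hc.trans (by omega)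
    calc _ ≤ (2 * M) * (2 * M) := Nat.mul_le_mul_right _ this
      _ = _ := by ring
  | succ K ih =>
    set a := (treeClass rep val K).card with ha
    have h1 : (treeClass rep val (K + 1)).card ≤ Fintype.card ν + p * Fintype.card κ * (a * a) := by
      rw [treeClass]
      refine (Finset.card_union_le _ _).trans (add_le_add hc (Finset.card_image_le.trans ?_))
      simp [Finset.card_product, ← ha]
    have h2 : Fintype.card ν ≤ Fintype.card ν * (a * a) := by
      rcases Nat.eq_zero_or_pos (Fintype.card ν) with h | h
      · simp [h]
      · obtain ⟨m⟩ := Fintype.card_pos_iff.1 h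
        have : 0 < a := Finset.card_pos.2 ⟨_, const_mem_treeClass K m⟩
        exact Nat.le_mul_of_pos_right _ (by positivity)
    have h3 : (treeClass rep val (K + 1)).card ≤ M * (a * a) := by
      rw [hM, add_mul]; exact h1.trans (by omega)
    calc _ ≤ (M * (a * a)) * (2 * M) := Nat.mul_le_mul_right _ h3
      _ ≤ (a * (2 * M)) * (a * (2 * M)) := by
          have : M * (a * a) * (2 * M) * 2 = (a * (2 * M)) * (a * (2 * M)) := by ring
          omega
      _ ≤ (2 * M) ^ 2 ^ (K + 1) * (2 * M) ^ 2 ^ (K + 1) := Nat.mul_le_mul ih ih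
      _ = _ := by rw [← pow_add]; congr 1; ring

end treeClass

/-! ### Approximation of CART outputs by the finite class -/

theorem abs_nodeMean_le {D : Data n p} {B : ℝ} (hB : 0 ≤ B) (hD : ∀ i, |(D i).2| ≤ B)
    (t : Set (Fin p → ℝ)) : |nodeMean D t| ≤ B := by
  rw [nodeMean, abs_div, Nat.abs_cast]
  refine div_le_of_le_mul₀ (by positivity) hB ((Finset.abs_sum_le_sum_abs _ _).trans ?_)
  refine (Finset.sum_le_sum fun i _ => hD i).trans ?_
  rw [Finset.sum_const, nsmul_eq_mul, mul_comm]; rfl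

theorem abs_outputFrom_le {D : Data n p} {B : ℝ} (hB : 0 ≤ B) (hD : ∀ i, |(D i).2| ≤ B)
    (T : Tree p) (t : Set (Fin p → ℝ)) (x : Fin p → ℝ) : |outputFrom D t T x| ≤ B := by
  induction T generalizing t with
  | leaf => exact abs_nodeMean_le hB hD t
  | split j s l r ihl ihr =>
    rw [outputFrom]; split_ifs
    exacts [ihl _, ihr _]

/-- Trees with arbitrary thresholds are approximated by the trees of the finite class. -/
theorem exists_treeClass_near {κ ν : Type*} [Fintype κ] [Fintype ν] {rep : Fin p → κ → ℝ}
    {val : ν → ℝ} {A : Fin p → κ → Set ℝ} {B ε : ℝ} (hB : 0 ≤ B)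
    (hval : ∀ v, |v| ≤ B → ∃ m, |val m - v| ≤ ε)
    (hA : ∀ j s, ∃ k, ∀ x, x ∉ A j k → (x ≤ s ↔ x ≤ rep j k))
    {D : Data n p} (hD : ∀ i, |(D i).2| ≤ B) (K : ℕ) (t : Set (Fin p → ℝ)) (T : Tree p)
    (hT : IsCART D K t T) :
    ∃ f ∈ treeClass rep val K, ∃ Q : Finset (Fin p × κ), Q.card + 1 ≤ 2 ^ K ∧
      ∀ x : Fin p → ℝ, (∀ q ∈ Q, x q.1 ∉ A q.1 q.2) → |f x - outputFrom D t T x| ≤ ε := by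
  classical
  induction K generalizing t T with
  | zero =>
    cases T with
    | leaf =>
      obtain ⟨m, hm⟩ := hval _ (abs_nodeMean_le hB hD t)
      exact ⟨_, const_mem_treeClass 0 m, ∅, by simp, fun x _ => hm⟩
    | split j s l r => exact hT.elim
  | succ K ih =>
    cases T with
    | leaf =>
      obtain ⟨m, hm⟩ := hval _ (abs_nodeMean_le hB hD t)
      exact ⟨_, const_mem_treeClass _ m, ∅, by simp [Nat.one_le_two_pow], fun x _ => hm⟩
    | split j s l r =>
      obtain ⟨-, -, hl, hr⟩ := hT
      obtain ⟨f, hf, Qf, hQf, hfx⟩ := ih _ _ hl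
      obtain ⟨g, hg, Qg, hQg, hgx⟩ := ih _ _ hr
      obtain ⟨k, hk⟩ := hA j s
      refine ⟨_, ite_mem_treeClass hf hg j k, insert (j, k) (Qf ∪ Qg), ?_, fun x hx => ?_⟩
      -- One gap for each internal node: `1 + (2^K - 1) + (2^K - 1) = 2^(K+1) - 1`.
      · have h1 := Finset.card_insert_le (j, k) (Qf ∪ Qg)
        have h2 := Finset.card_union_le Qf Qg
        rw [pow_succ]; omega
      · simp only [Finset.mem_insert, Finset.mem_union, forall_eq_or_imp] at hx
        have hiff := hk (x j) hx.1
        rw [outputFrom]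
        by_cases h : x j ≤ s
        · rw [if_pos h, if_pos (hiff.1 h)]
          exact hfx x fun q hq => hx.2 q (Or.inl hq)
        · rw [if_neg h, if_neg fun h' => h (hiff.2 h')]
          exact hgx x fun q hq => hx.2 q (Or.inr hq)

theorem measurable_outputFrom (D : Data n p) (T : Tree p) (t : Set (Fin p → ℝ)) :
    Measurable (outputFrom D t T) := by
  induction T generalizing t with
  | leaf => exact measurable_const
  | split j s l r ihl ihr =>
    exact Measurable.ite (measurableSet_le (measurable_pi_apply j) measurable_const) (ihl _) (ihr _)

/-! ### Exponential moments and maxima -/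

section exponentialMoments

variable {Ω : Type*} [MeasurableSpace Ω] {P : Measure Ω}

/-- Finitely many variables with bounded exponential moments have an integrable majorant whose
expectation is logarithmic in their number. -/
theorem exists_integrable_majorant [IsProbabilityMeasure P] {ι : Type*} (s : Finset ι)
    (U : ι → Ω → ℝ) {c : ℝ} (hc : 0 < c) (hs : s.Nonempty)
    (hint : ∀ i ∈ s, Integrable (fun ω => Real.exp (U i ω)) P)
    (hle : ∀ i ∈ s, ∫ ω, Real.exp (U i ω) ∂P ≤ c) :
    ∃ h : Ω → ℝ, Integrable h P ∧ (∀ i ∈ s, ∀ ω, U i ω ≤ h ω) ∧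
      ∫ ω, h ω ∂P ≤ Real.log (s.card * c) := by
  have hcard : (0 : ℝ) < s.card := by exact_mod_cast hs.card_pos
  set m : ℝ := s.card * c with hm
  have hm0 : 0 < m := by positivity
  have hS : Integrable (fun ω => ∑ i ∈ s, Real.exp (U i ω)) P := integrable_finsetSum s hint
  -- The tangent to the logarithm at `m`, evaluated at the sum of the exponentials; it dominates the
  -- log of the sum, hence every `U i`.
  refine ⟨fun ω => Real.log m - 1 + (∑ i ∈ s, Real.exp (U i ω)) / m,
    (integrable_const _).add (hS.div_const m), fun i hi ω => ?_, ?_⟩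
  · have h1 : Real.exp (U i ω) ≤ ∑ i ∈ s, Real.exp (U i ω) :=
      Finset.single_le_sum (f := fun i => Real.exp (U i ω)) (fun _ _ => (Real.exp_pos _).le) hi
    have h2 : Real.exp (U i ω) / m ≤ (∑ i ∈ s, Real.exp (U i ω)) / m := by gcongr
    have h3 := Real.log_le_sub_one_of_pos (x := Real.exp (U i ω) / m) (by positivity)
    rw [Real.log_div (Real.exp_ne_zero _) hm0.ne', Real.log_exp] at h3
    simp only; linarith
  · rw [integral_add (integrable_const _) (hS.div_const m), integral_div, integral_finsetSum s hint]
    simp only [integral_const, probReal_univ, one_smul]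
    have : (∑ i ∈ s, ∫ ω, Real.exp (U i ω) ∂P) / m ≤ 1 := by
      rw [div_le_one hm0, hm]
      calc _ ≤ ∑ _i ∈ s, c := Finset.sum_le_sum hle
        _ = _ := by simp
    linarith

variable {E : Type*} [MeasurableSpace E] {ρ : Measure E} {Z : Fin n → Ω → E}

theorem integrable_exp_sum_and_integral_le (hZ : ∀ i, Measurable (Z i))
    (hlaw : ∀ i, P.map (Z i) = ρ) (hind : iIndepFun Z P) {ψ : E → ℝ} (hψ : Measurable ψ) {M c : ℝ}
    (hbd : ∀ᵐ z ∂ρ, |ψ z| ≤ M) (hc : ∫ z, Real.exp (ψ z) ∂ρ ≤ c) :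
    Integrable (fun ω => Real.exp (∑ i, ψ (Z i ω))) P ∧
      ∫ ω, Real.exp (∑ i, ψ (Z i ω)) ∂P ≤ c ^ n := by
  have hP := hind.isProbabilityMeasure
  constructor
  · have hmeas : Measurable (fun ω => Real.exp (∑ i, ψ (Z i ω))) :=
      (Finset.measurable_sum _ fun i _ => hψ.comp (hZ i)).exp
    refine Integrable.of_bound hmeas.aestronglyMeasurable (Real.exp (n * M)) ?_
    have : ∀ᵐ ω ∂P, ∀ i, |ψ (Z i ω)| ≤ M :=
      ae_all_iff.2 fun i => ae_of_ae_map (hZ i).aemeasurable ((hlaw i).symm ▸ hbd)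
    filter_upwards [this] with ω hω
    rw [Real.norm_eq_abs, abs_of_pos (Real.exp_pos _), Real.exp_le_exp]
    calc _ ≤ ∑ _i : Fin n, M := Finset.sum_le_sum fun i _ => (le_abs_self _).trans (hω i)
      _ = _ := by simp
  · have h1 := (hind.comp (fun _ => ψ) (fun _ => hψ)).mgf_sum (t := 1)
      (fun i => hψ.comp (hZ i)) Finset.univ
    have h2 : ∀ i, mgf (ψ ∘ Z i) P 1 = ∫ z, Real.exp (ψ z) ∂ρ := by
      intro i
      rw [← hlaw i, integral_map (hZ i).aemeasurable hψ.exp.aestronglyMeasurable]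
      simp [mgf]
    simp only [h2, Finset.prod_const, Finset.card_univ, Fintype.card_fin] at h1
    simp only [mgf, one_mul, Finset.sum_apply, Function.comp_apply] at h1
    rw [h1]
    exact pow_le_pow_left₀ (integral_nonneg fun z => (Real.exp_pos _).le) hc n

/-- With `ρ(A) ≤ 1/n`, the `n`-th power of this bound is `exp 2`: the number of sample points in a
gap has a bounded exponential moment. -/
theorem integral_exp_indicator_le [IsProbabilityMeasure ρ] {A : Set E} (hA : MeasurableSet A) :
    ∫ z, Real.exp (A.indicator 1 z) ∂ρ ≤ Real.exp (2 * ρ.real A) := by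
  have h1 : ∀ z, Real.exp (A.indicator 1 z) = 1 + (Real.exp 1 - 1) * A.indicator 1 z := by
    intro z
    by_cases hz : z ∈ A <;> simp [hz]
  have hi : Integrable (A.indicator (1 : E → ℝ)) ρ :=
    (integrable_const (1 : ℝ)).indicator hA
  simp_rw [h1]
  rw [integral_add (integrable_const _) (hi.const_mul _), integral_const_mul,
    integral_indicator_one hA]
  simp only [integral_const, probReal_univ, one_smul]
  have h2 := Real.add_one_le_exp (2 * ρ.real A)
  have h3 : Real.exp 1 - 1 ≤ 2 := by linarith [Real.exp_one_lt_d9]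
  have h4 : 0 ≤ ρ.real A := measureReal_nonneg
  nlinarith

end exponentialMoments

/-! ### Excess loss and the regression function -/

section loss

variable {ρ : Measure ((Fin p → ℝ) × ℝ)} {μ : (Fin p → ℝ) → ℝ} {B : ℝ}

/-- The excess of the squared loss of `f` over the one of `μ`. -/
def excessLoss (μ f : (Fin p → ℝ) → ℝ) (z : (Fin p → ℝ) × ℝ) : ℝ :=
  (f z.1 - z.2) ^ 2 - (μ z.1 - z.2) ^ 2

theorem IsRegressionFunction.ae_abs_le (hμ : IsRegressionFunction ρ μ)
    (hY : ∀ᵐ z ∂ρ, |z.2| ≤ B) : ∀ᵐ z ∂ρ, |μ z.1| ≤ B := by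
  have h := ae_bdd_abs_condExp_of_ae_bdd_abs (m := MeasurableSpace.comap Prod.fst inferInstance)
    (μ := ρ) (f := fun z : (Fin p → ℝ) × ℝ => z.2) hY
  filter_upwards [hμ.2, h] with z h1 h2
  rw [h1]; exact h2

/-- Orthogonality of the noise to functions of the predictors, by pulling `φ` out of the conditional
expectation. -/
theorem IsRegressionFunction.integral_mul_sub [IsProbabilityMeasure ρ]
    (hμ : IsRegressionFunction ρ μ) (hY : ∀ᵐ z ∂ρ, |z.2| ≤ B) {φ : (Fin p → ℝ) → ℝ}
    (hφ : Integrable φ ρ.fst) :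
    Integrable (fun z => φ z.1 * (μ z.1 - z.2)) ρ ∧ ∫ z, φ z.1 * (μ z.1 - z.2) ∂ρ = 0 := by
  have hφm := hφ.aestronglyMeasurable
  wlog hm : Measurable φ generalizing φ
  · have h1 := this (hφ.congr hφm.ae_eq_mk) hφm.stronglyMeasurable_mk.aestronglyMeasurable
      hφm.stronglyMeasurable_mk.measurable
    have h2 : (fun z : (Fin p → ℝ) × ℝ => hφm.mk φ z.1 * (μ z.1 - z.2)) =ᵐ[ρ]
        fun z => φ z.1 * (μ z.1 - z.2) := by
      filter_upwards [ae_of_ae_map measurable_fst.aemeasurable hφm.ae_eq_mk] with z hz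
      rw [hz]
    exact ⟨h1.1.congr h2, by rw [← integral_congr_ae h2]; exact h1.2⟩
  have hφ1 : Integrable (fun z : (Fin p → ℝ) × ℝ => φ z.1) ρ :=
    (integrable_map_measure hφm measurable_fst.aemeasurable).1 hφ
  have i1 : Integrable (fun z : (Fin p → ℝ) × ℝ => φ z.1 * z.2) ρ :=
    hφ1.mul_bdd (c := B) measurable_snd.aestronglyMeasurable hY
  have i2 : Integrable (fun z : (Fin p → ℝ) × ℝ => φ z.1 * μ z.1) ρ :=
    hφ1.mul_bdd (c := B) (hμ.1.comp measurable_fst).aestronglyMeasurable (hμ.ae_abs_le hY)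
  have iY : Integrable (fun z : (Fin p → ℝ) × ℝ => z.2) ρ :=
    Integrable.of_bound measurable_snd.aestronglyMeasurable B hY
  have hle : MeasurableSpace.comap (Prod.fst : (Fin p → ℝ) × ℝ → _) inferInstance ≤
      (inferInstance : MeasurableSpace ((Fin p → ℝ) × ℝ)) := measurable_fst.comap_le
  have hsm : StronglyMeasurable[MeasurableSpace.comap Prod.fst inferInstance]
      (fun z : (Fin p → ℝ) × ℝ => φ z.1) :=
    (hm.comp (comap_measurable Prod.fst)).stronglyMeasurable
  have hpull := condExp_mul_of_stronglyMeasurable_left (μ := ρ) hsm i1 iY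
  have heq : ∫ z, φ z.1 * μ z.1 ∂ρ = ∫ z, φ z.1 * z.2 ∂ρ := by
    rw [← integral_condExp hle (f := fun z : (Fin p → ℝ) × ℝ => φ z.1 * z.2)]
    refine integral_congr_ae ?_
    filter_upwards [hpull, hμ.2] with z h1 h2
    rw [h2]; exact h1.symm
  have e : (fun z : (Fin p → ℝ) × ℝ => φ z.1 * (μ z.1 - z.2)) =
      fun z => φ z.1 * μ z.1 - φ z.1 * z.2 := by ext z; ring
  rw [e]
  exact ⟨i2.sub i1, by rw [integral_sub i2 i1, heq, sub_self]⟩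

/-- The cross term vanishes by orthogonality. Only `f - μ` is required to be square integrable, so
unbounded oracle functions are covered. -/
theorem IsRegressionFunction.integral_excessLoss [IsProbabilityMeasure ρ]
    (hμ : IsRegressionFunction ρ μ) (hY : ∀ᵐ z ∂ρ, |z.2| ≤ B) {f : (Fin p → ℝ) → ℝ}
    (hf : MemLp (fun x => f x - μ x) 2 ρ.fst) :
    Integrable (excessLoss μ f) ρ ∧
      ∫ z, excessLoss μ f z ∂ρ = ∫ x, (f x - μ x) ^ 2 ∂ρ.fst := by
  obtain ⟨i1, h1⟩ := hμ.integral_mul_sub hY (hf.integrable one_le_two)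
  have i2 := hf.integrable_sq
  have i3 : Integrable (fun z : (Fin p → ℝ) × ℝ => (f z.1 - μ z.1) ^ 2) ρ :=
    (integrable_map_measure i2.aestronglyMeasurable measurable_fst.aemeasurable).1 i2
  have e : excessLoss μ f =
      fun z => (f z.1 - μ z.1) ^ 2 + 2 * ((f z.1 - μ z.1) * (μ z.1 - z.2)) := by
    ext z; simp only [excessLoss]; ring
  rw [e]
  refine ⟨i3.add (i1.const_mul 2), ?_⟩
  rw [integral_add i3 (i1.const_mul 2), integral_const_mul, h1, mul_zero, add_zero, Measure.fst,
    integral_map measurable_fst.aemeasurable i2.aestronglyMeasurable]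

/-- The exponential moment bound behind the fast rate. -/
theorem IsRegressionFunction.integral_exp_excessLoss_le [IsProbabilityMeasure ρ] (hB : 0 < B)
    (hμ : IsRegressionFunction ρ μ) (hY : ∀ᵐ z ∂ρ, |z.2| ≤ B) {f : (Fin p → ℝ) → ℝ}
    (hf : Measurable f) (hfB : ∀ x, |f x| ≤ B) :
    ∫ z, Real.exp (1 / (32 * B ^ 2) *
      ((∫ x, (f x - μ x) ^ 2 ∂ρ.fst) / 2 - excessLoss μ f z)) ∂ρ ≤ 1 ∧
    ∀ᵐ z ∂ρ, |1 / (32 * B ^ 2) *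
      ((∫ x, (f x - μ x) ^ 2 ∂ρ.fst) / 2 - excessLoss μ f z)| ≤ 1 := by
  have hμB := hμ.ae_abs_le hY
  have hdiff : ∀ᵐ z ∂ρ, |f z.1 - μ z.1| ≤ 2 * B := by
    filter_upwards [hμB] with z hz
    exact (abs_sub _ _).trans (by linarith [hfB z.1])
  have hdiff' : ∀ᵐ x ∂ρ.fst, |f x - μ x| ≤ 2 * B := by
    refine (ae_map_iff measurable_fst.aemeasurable ?_).2 hdiff
    exact measurableSet_le (hf.sub hμ.1).abs measurable_const
  have hmem : MemLp (fun x => f x - μ x) 2 ρ.fst :=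
    MemLp.of_bound (hf.sub hμ.1).aestronglyMeasurable (2 * B) hdiff'
  obtain ⟨iZ, hZ⟩ := hμ.integral_excessLoss hY hmem
  set W := ∫ x, (f x - μ x) ^ 2 ∂ρ.fst with hW
  have i2 := hmem.integrable_sq
  have i3 : Integrable (fun z : (Fin p → ℝ) × ℝ => (f z.1 - μ z.1) ^ 2) ρ :=
    (integrable_map_measure i2.aestronglyMeasurable measurable_fst.aemeasurable).1 i2
  have hW' : ∫ z : (Fin p → ℝ) × ℝ, (f z.1 - μ z.1) ^ 2 ∂ρ = W := by
    rw [hW, Measure.fst, integral_map measurable_fst.aemeasurable i2.aestronglyMeasurable]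
  have hW0 : 0 ≤ W := integral_nonneg fun x => sq_nonneg _
  have hW4 : W ≤ 4 * B ^ 2 := by
    have : W ≤ ∫ _x, 4 * B ^ 2 ∂ρ.fst := by
      refine integral_mono_ae i2 (integrable_const _) ?_
      filter_upwards [hdiff'] with x hx
      have := sq_le_sq' (by linarith [abs_le.1 hx]) (abs_le.1 hx).2
      linarith
    simpa using this
  set a := 1 / (32 * B ^ 2) with ha
  have ha0 : 0 < a := by positivity
  have haB : a * B ^ 2 = 1 / 32 := by rw [ha]; field_simp
  -- The loss difference factors through `f - μ`, so its second moment is controlled by its own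
  -- mean; this is the source of the fast rate.
  have hsq : ∀ᵐ z ∂ρ, excessLoss μ f z ^ 2 ≤ 16 * B ^ 2 * (f z.1 - μ z.1) ^ 2 ∧
      |excessLoss μ f z| ≤ 8 * B ^ 2 := by
    filter_upwards [hμB, hY, hdiff] with z h1 h2 h3
    have h4 : |f z.1 + μ z.1 - 2 * z.2| ≤ 4 * B := by
      obtain ⟨a1, a2⟩ := abs_le.1 h1
      obtain ⟨b1, b2⟩ := abs_le.1 h2
      obtain ⟨c1, c2⟩ := abs_le.1 (hfB z.1)
      rw [abs_le]; constructor <;> linarith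
    have e : excessLoss μ f z = (f z.1 - μ z.1) * (f z.1 + μ z.1 - 2 * z.2) := by
      simp only [excessLoss]; ring
    constructor
    · rw [e, mul_pow, mul_comm]
      have := sq_le_sq' (by linarith [abs_le.1 h4]) (abs_le.1 h4).2
      refine mul_le_mul_of_nonneg_right ?_ (sq_nonneg _)
      linarith
    · rw [e, abs_mul]
      calc _ ≤ 2 * B * (4 * B) := mul_le_mul h3 h4 (abs_nonneg _) (by positivity)
        _ = _ := by ring
  constructor
  · have hpt : ∀ᵐ z ∂ρ, Real.exp (a * (W / 2 - excessLoss μ f z)) ≤ Real.exp (a * W / 2) *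
        (1 - a * excessLoss μ f z + a ^ 2 * (16 * B ^ 2) * (f z.1 - μ z.1) ^ 2) := by
      filter_upwards [hsq] with z hz
      have e : a * (W / 2 - excessLoss μ f z) = a * W / 2 + -(a * excessLoss μ f z) := by ring
      rw [e, Real.exp_add]
      refine mul_le_mul_of_nonneg_left ?_ (Real.exp_pos _).le
      have h1 : |-(a * excessLoss μ f z)| ≤ 1 := by
        rw [abs_neg, abs_mul, abs_of_pos ha0]
        have := mul_le_mul_of_nonneg_left hz.2 ha0.le
        nlinarith
      have h2 := (abs_le.1 (Real.abs_exp_sub_one_sub_id_le h1)).2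
      have h3 := mul_le_mul_of_nonneg_left hz.1 (sq_nonneg a)
      nlinarith
    have iL : Integrable (fun z => 1 - a * excessLoss μ f z) ρ :=
      (integrable_const _).sub (iZ.const_mul a)
    have iR : Integrable (fun z : (Fin p → ℝ) × ℝ => Real.exp (a * W / 2) *
        (1 - a * excessLoss μ f z + a ^ 2 * (16 * B ^ 2) * (f z.1 - μ z.1) ^ 2)) ρ :=
      (iL.add (i3.const_mul _)).const_mul _
    refine (integral_mono_of_nonneg (ae_of_all _ fun z => (Real.exp_pos _).le) iR hpt).trans ?_
    rw [integral_const_mul, integral_add iL (i3.const_mul _),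
      integral_sub (integrable_const _) (iZ.const_mul a), integral_const_mul,
      integral_const_mul, hZ, hW']
    simp only [integral_const, probReal_univ, one_smul]
    -- The scale `a` is chosen so that the quadratic term is exactly half of the linear one; what
    -- remains cancels against `exp (a W / 2)`.
    have e : 1 - a * W + a ^ 2 * (16 * B ^ 2) * W = 1 - a * W / 2 := by
      linear_combination (16 * a * W) * haB
    rw [e]
    calc _ ≤ Real.exp (a * W / 2) * Real.exp (-(a * W / 2)) := by
          refine mul_le_mul_of_nonneg_left ?_ (Real.exp_pos _).le
          linarith [Real.add_one_le_exp (-(a * W / 2))]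
      _ = 1 := by rw [← Real.exp_add]; simp
  · filter_upwards [hsq] with z hz
    rw [abs_mul, abs_of_pos ha0]
    have h1 : |W / 2 - excessLoss μ f z| ≤ 32 * B ^ 2 := by
      obtain ⟨b1, b2⟩ := abs_le.1 hz.2
      rw [abs_le]; constructor <;> nlinarith
    calc _ ≤ a * (32 * B ^ 2) := mul_le_mul_of_nonneg_left h1 ha0.le
      _ = 1 := by rw [ha]; field_simp

end loss

/-! ### Uniform deviation bound for CART trees -/

/-- Cost of replacing `v` by `u` in a squared loss: off the gaps the two are `ε`-close, and inside a
gap the trivial bound `4 B²` is paid for by an indicator. -/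
theorem sq_sub_le_sq_sub_add {E κ : Type*} (Q : Finset κ) (A : κ → Set E) (x : E) {B ε u v y : ℝ}
    (hε : 0 ≤ ε) (hu : |u| ≤ B) (hv : |v| ≤ B) (hy : |y| ≤ B)
    (h : (∀ q ∈ Q, x ∉ A q) → |u - v| ≤ ε) :
    (u - y) ^ 2 ≤ (v - y) ^ 2 + (4 * B * ε + 4 * B ^ 2 * ∑ q ∈ Q, (A q).indicator 1 x) := by
  have hB : 0 ≤ B := (abs_nonneg _).trans hu
  have hnn : ∀ q ∈ Q, 0 ≤ (A q).indicator (1 : E → ℝ) x :=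
    fun q _ => Set.indicator_nonneg (fun _ _ => zero_le_one) x
  obtain ⟨u1, u2⟩ := abs_le.1 hu
  obtain ⟨v1, v2⟩ := abs_le.1 hv
  obtain ⟨y1, y2⟩ := abs_le.1 hy
  by_cases hx : ∀ q ∈ Q, x ∉ A q
  · have h1 := h hx
    have h2 : 0 ≤ 4 * B ^ 2 * ∑ q ∈ Q, (A q).indicator (1 : E → ℝ) x :=
      mul_nonneg (by positivity) (Finset.sum_nonneg hnn)
    have h3 : (u - v) * (u + v - 2 * y) ≤ ε * (4 * B) := by
      refine (le_abs_self _).trans ?_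
      rw [abs_mul]
      exact mul_le_mul h1 (by rw [abs_le]; constructor <;> linarith) (abs_nonneg _) hε
    linarith [show (u - y) ^ 2 - (v - y) ^ 2 = (u - v) * (u + v - 2 * y) by ring]
  · push Not at hx
    obtain ⟨q, hq, hxq⟩ := hx
    have h1 : 1 ≤ ∑ q ∈ Q, (A q).indicator (1 : E → ℝ) x :=
      (by simp [hxq] : (1 : ℝ) ≤ (A q).indicator (1 : E → ℝ) x).trans
        (Finset.single_le_sum (f := fun q => (A q).indicator (1 : E → ℝ) x) hnn hq)
    have h2 : (u - y) ^ 2 ≤ (2 * B) ^ 2 := sq_le_sq' (by linarith) (by linarith)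
    have h3 : 4 * B ^ 2 * 1 ≤ 4 * B ^ 2 * ∑ q ∈ Q, (A q).indicator (1 : E → ℝ) x :=
      mul_le_mul_of_nonneg_left h1 (by positivity)
    have h4 : 0 ≤ 4 * B * ε := by positivity
    nlinarith [sq_nonneg (v - y)]

/-- The logarithm of the cardinality of the finite class of trees. -/
theorem log_card_treeClass_le {n p : ℕ} (hnp : 2 ≤ n * p) {rep : Fin p → Fin (n + 1) → ℝ}
    {val : Fin (2 * n + 1) → ℝ} (K : ℕ) :
    Real.log (treeClass rep val K).card ≤ 10 * (2 ^ K * Real.log ((n : ℝ) * p)) := by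
  have hn : 0 < n := Nat.pos_of_ne_zero (by rintro rfl; simp at hnp)
  have hp : 0 < p := Nat.pos_of_ne_zero (by rintro rfl; simp at hnp)
  have h := card_treeClass_le (rep := rep) (val := val) K
  simp only [Fintype.card_fin] at h
  set M := 2 * (2 * n + 1 + p * (n + 1)) with hM
  have hM0 : 0 < M := by omega
  have hF : 0 < (treeClass rep val K).card := Finset.card_pos.2 ⟨_, const_mem_treeClass K 0⟩
  have hMt : M ≤ (n * p) ^ 5 := by
    have h1 : n ≤ n * p := Nat.le_mul_of_pos_right n hp
    have h2 : p ≤ n * p := Nat.le_mul_of_pos_left p hn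
    have h3 : M ≤ 10 * (n * p) := by
      have : p * (n + 1) = n * p + p := by ring
      omega
    have h4 : 2 ^ 4 ≤ (n * p) ^ 4 := Nat.pow_le_pow_left hnp 4
    calc M ≤ 10 * (n * p) := h3
      _ ≤ (n * p) ^ 4 * (n * p) := Nat.mul_le_mul_right _ (by omega)
      _ = _ := by ring
  have hle : (treeClass rep val K).card ≤ (n * p) ^ (5 * 2 ^ (K + 1)) := by
    calc _ ≤ _ := Nat.le_mul_of_pos_right _ hM0
      _ ≤ M ^ 2 ^ (K + 1) := h
      _ ≤ ((n * p) ^ 5) ^ 2 ^ (K + 1) := Nat.pow_le_pow_left hMt _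
      _ = _ := by rw [← pow_mul]
  have : Real.log (treeClass rep val K).card ≤
      Real.log (((n : ℝ) * p) ^ (5 * 2 ^ (K + 1))) := by
    refine Real.log_le_log (by exact_mod_cast hF) ?_
    exact_mod_cast hle
  refine this.trans_eq ?_
  rw [Real.log_pow]; push_cast; ring

theorem two_thirds_le_log {n p : ℕ} (hnp : 2 ≤ n * p) : 2 / 3 ≤ Real.log ((n : ℝ) * p) := by
  have h1 : Real.log 2 ≤ Real.log ((n : ℝ) * p) :=
    Real.log_le_log two_pos (by exact_mod_cast hnp)
  linarith [Real.log_two_gt_d9]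

/-- The uniform deviation inequality for depth `K` trees. -/
theorem exists_deviation_majorant {B : ℝ} (hB : 0 < B) {n p : ℕ} (K : ℕ) (hnp : 2 ≤ n * p)
    {ρ : Measure ((Fin p → ℝ) × ℝ)} [IsProbabilityMeasure ρ] (hY : ∀ᵐ z ∂ρ, |z.2| ≤ B)
    {μ : (Fin p → ℝ) → ℝ} (hμ : IsRegressionFunction ρ μ)
    {Ω : Type*} [MeasurableSpace Ω] {P : Measure Ω} {Z : Fin n → Ω → (Fin p → ℝ) × ℝ}
    (hZ : ∀ i, Measurable (Z i)) (hlaw : ∀ i, P.map (Z i) = ρ) (hind : iIndepFun Z P) :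
    ∃ H : Ω → ℝ, Integrable H P ∧
      ∫ ω, H ω ∂P ≤ 720 * B ^ 2 * (2 ^ K * Real.log ((n : ℝ) * p) / n) ∧
      ∀ᵐ ω ∂P, ∀ T, IsCARTTree (fun i => Z i ω) K T →
        ∫ x, (output (fun i => Z i ω) T x - μ x) ^ 2 ∂ρ.fst ≤
          2 / n * ∑ i, excessLoss μ (output (fun i => Z i ω) T) (Z i ω) + H ω := by
  have hP := hind.isProbabilityMeasure
  have hn : 0 < n := Nat.pos_of_ne_zero (by rintro rfl; simp at hnp)
  have hp : 0 < p := Nat.pos_of_ne_zero (by rintro rfl; simp at hnp)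
  have hn0 : (0 : ℝ) < n := by exact_mod_cast hn
  have hp0 : (0 : ℝ) < p := by exact_mod_cast hp
  have : ∀ j, IsProbabilityMeasure (ρ.fst.map (fun x => x j)) := fun j =>
    Measure.isProbabilityMeasure_map (measurable_pi_apply j).aemeasurable
  -- The nets depend on `ρ` alone, not on the sample, so the finite class is deterministic and
  -- independence can be used.
  choose rep A hAm hAν hA using fun j => exists_threshold_net (ρ.fst.map (fun x => x j)) hn
  set val : Fin (2 * n + 1) → ℝ := fun m => -B + m * (B / n) with hval
  set F := treeClass rep val K with hF
  set a := 1 / (32 * B ^ 2) with ha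
  have ha0 : 0 < a := by positivity
  set W : ((Fin p → ℝ) → ℝ) → ℝ := fun f => ∫ x, (f x - μ x) ^ 2 ∂ρ.fst with hW
  have hFm : ∀ f ∈ F, Measurable f := fun f hf => measurable_of_mem_treeClass hf
  have hFB : ∀ f ∈ F, ∀ x, |f x| ≤ B := fun f hf =>
    abs_le_of_mem_treeClass (fun m => abs_grid_le hB hn m) hf
  -- fluctuations over the finite class
  obtain ⟨h, hhi, hhle, hhint⟩ := exists_integrable_majorant (P := P) F
    (fun f ω => ∑ i, a * (W f / 2 - excessLoss μ f (Z i ω))) one_pos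
    ⟨_, const_mem_treeClass K 0⟩
    (fun f hf => (integrable_exp_sum_and_integral_le hZ hlaw hind
      (ψ := fun z => a * (W f / 2 - excessLoss μ f z))
      (by have := hFm f hf; have := hμ.1; unfold excessLoss; fun_prop)
      (hμ.integral_exp_excessLoss_le hB hY (hFm f hf) (hFB f hf)).2
      (hμ.integral_exp_excessLoss_le hB hY (hFm f hf) (hFB f hf)).1).1)
    (fun f hf => ((integrable_exp_sum_and_integral_le hZ hlaw hind
      (ψ := fun z => a * (W f / 2 - excessLoss μ f z))
      (by have := hFm f hf; have := hμ.1; unfold excessLoss; fun_prop)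
      (hμ.integral_exp_excessLoss_le hB hY (hFm f hf) (hFB f hf)).2
      (hμ.integral_exp_excessLoss_le hB hY (hFm f hf) (hFB f hf)).1).2).trans_eq (one_pow n))
  rw [mul_one] at hhint
  -- numbers of observations in the gaps of the nets
  set G : Fin p × Fin (n + 1) → Set (Fin p → ℝ) := fun q => {x | x q.1 ∈ A q.1 q.2} with hG
  have hGm : ∀ q, MeasurableSet (G q) := fun q => measurable_pi_apply q.1 (hAm q.1 q.2)
  have hGρ : ∀ q, ρ.fst.real (G q) ≤ 1 / n := by
    intro q
    refine le_of_eq_of_le ?_ (hAν q.1 q.2)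
    rw [map_measureReal_apply (measurable_pi_apply q.1) (hAm q.1 q.2)]
    rfl
  set G' : Fin p × Fin (n + 1) → Set ((Fin p → ℝ) × ℝ) := fun q => Prod.fst ⁻¹' G q with hG'
  have hGm' : ∀ q, MeasurableSet (G' q) := fun q => measurable_fst (hGm q)
  have hGρ' : ∀ q, ρ.real (G' q) ≤ 1 / n := by
    intro q
    refine le_of_eq_of_le ?_ (hGρ q)
    rw [Measure.fst, map_measureReal_apply measurable_fst (hGm q)]
  have hcount : ∀ q, Integrable (fun ω => Real.exp (∑ i, (G' q).indicator 1 (Z i ω))) P ∧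
      ∫ ω, Real.exp (∑ i, (G' q).indicator 1 (Z i ω)) ∂P ≤ Real.exp 2 := by
    intro q
    have h1 := integrable_exp_sum_and_integral_le hZ hlaw hind
      (ψ := (G' q).indicator 1) (M := 1) (c := Real.exp (2 * (1 / n)))
      (measurable_one.indicator (hGm' q))
      (ae_of_all _ fun z => by by_cases hz : z ∈ G' q <;> simp [hz])
      ((integral_exp_indicator_le (hGm' q)).trans
        (Real.exp_le_exp.2 (mul_le_mul_of_nonneg_left (hGρ' q) zero_le_two)))
    refine ⟨h1.1, h1.2.trans_eq ?_⟩
    rw [← Real.exp_nat_mul]; congr 1; field_simp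
  obtain ⟨g, hgi, hgle, hgint⟩ := exists_integrable_majorant (P := P) Finset.univ
    (fun q ω => ∑ i, (G' q).indicator (1 : (Fin p → ℝ) × ℝ → ℝ) (Z i ω)) (Real.exp_pos 2)
    ⟨(⟨0, hp⟩, 0), Finset.mem_univ _⟩ (fun q _ => (hcount q).1) (fun q _ => (hcount q).2)
  have hg0 : ∀ ω, 0 ≤ g ω := fun ω => (Finset.sum_nonneg fun i _ =>
    Set.indicator_nonneg (fun _ _ => zero_le_one) _).trans
      (hgle (⟨0, hp⟩, 0) (Finset.mem_univ _) ω)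
  set L := Real.log ((n : ℝ) * p) with hL
  have hL0 : 2 / 3 ≤ L := two_thirds_le_log hnp
  have h2K : (1 : ℝ) ≤ 2 ^ K := one_le_pow₀ one_le_two
  -- Here `64 B² = 2/a`. The `g` term counts sample points in the gaps; the constants collect the
  -- grid error (`4 B²` in the risk, `8 B²` in the sample) and the mass of the gaps.
  refine ⟨fun ω => 64 * B ^ 2 / n * h ω + 8 * B ^ 2 * 2 ^ K / n * g ω +
    (12 * B ^ 2 + 4 * B ^ 2 * 2 ^ K) / n,
    ((hhi.const_mul _).add (hgi.const_mul _)).add (integrable_const _), ?_, ?_⟩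
  · have ig : ∫ ω, g ω ∂P ≤ 5 * L := by
      refine hgint.trans ?_
      have hc : ((Finset.univ : Finset (Fin p × Fin (n + 1))).card : ℝ) ≤ ((n : ℝ) * p) ^ 2 := by
        have h1 : p * (n + 1) ≤ (n * p) ^ 2 := by
          have h2 : p ≤ n * p := Nat.le_mul_of_pos_left p hn
          have : p * (n + 1) = n * p + p := by ring
          nlinarith
        simp only [Finset.card_univ, Fintype.card_prod, Fintype.card_fin]
        exact_mod_cast h1
      have hc0 : (0 : ℝ) < (Finset.univ : Finset (Fin p × Fin (n + 1))).card := by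
        simp only [Finset.card_univ, Fintype.card_prod, Fintype.card_fin]; positivity
      rw [Real.log_mul hc0.ne' (Real.exp_ne_zero _), Real.log_exp]
      have h3 := Real.log_le_log hc0 hc
      rw [Real.log_pow] at h3
      push_cast at h3
      linarith
    have ih : ∫ ω, h ω ∂P ≤ 10 * (2 ^ K * L) := hhint.trans (log_card_treeClass_le hnp K)
    have i1 : Integrable (fun ω => 64 * B ^ 2 / n * h ω + 8 * B ^ 2 * 2 ^ K / n * g ω) P :=
      (hhi.const_mul _).add (hgi.const_mul _)
    rw [integral_add i1 (integrable_const _), integral_add (hhi.const_mul _) (hgi.const_mul _),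
      integral_const_mul, integral_const_mul]
    simp only [integral_const, probReal_univ, one_smul]
    have e1 : 64 * B ^ 2 / n * ∫ ω, h ω ∂P ≤ 64 * B ^ 2 / n * (10 * (2 ^ K * L)) :=
      mul_le_mul_of_nonneg_left ih (by positivity)
    have e2 : 8 * B ^ 2 * 2 ^ K / n * ∫ ω, g ω ∂P ≤ 8 * B ^ 2 * 2 ^ K / n * (5 * L) :=
      mul_le_mul_of_nonneg_left ig (by positivity)
    have e3 : (12 * B ^ 2 + 4 * B ^ 2 * 2 ^ K) / n ≤ (24 * B ^ 2 * (2 ^ K * L)) / n := by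
      have f1 : 2 ^ K * (2 / 3) ≤ 2 ^ K * L := mul_le_mul_of_nonneg_left hL0 (by positivity)
      have f2 : 12 + 4 * (2 : ℝ) ^ K ≤ 24 * (2 ^ K * L) := by linarith
      refine div_le_div_of_nonneg_right ?_ hn0.le
      nlinarith [mul_le_mul_of_nonneg_left f2 (sq_nonneg B)]
    calc _ ≤ 64 * B ^ 2 / n * (10 * (2 ^ K * L)) + 8 * B ^ 2 * 2 ^ K / n * (5 * L) +
          (24 * B ^ 2 * (2 ^ K * L)) / n := by linarith
      _ = 704 * B ^ 2 * (2 ^ K * L / n) := by ring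
      _ ≤ _ := by gcongr; norm_num
  · have hYB : ∀ᵐ ω ∂P, ∀ i, |(Z i ω).2| ≤ B :=
      ae_all_iff.2 fun i => ae_of_ae_map (hZ i).aemeasurable ((hlaw i).symm ▸ hY)
    have hμB : ∀ᵐ x ∂ρ.fst, |μ x| ≤ B :=
      (ae_map_iff measurable_fst.aemeasurable (measurableSet_le hμ.1.abs measurable_const)).2
        (hμ.ae_abs_le hY)
    have hmem : ∀ f : (Fin p → ℝ) → ℝ, Measurable f → (∀ x, |f x| ≤ B) →
        Integrable (fun x => (f x - μ x) ^ 2) ρ.fst := by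
      intro f hf hfB
      refine (MemLp.of_bound (hf.sub hμ.1).aestronglyMeasurable (2 * B) ?_).integrable_sq
      filter_upwards [hμB] with x hx
      exact (abs_sub _ _).trans (by linarith [hfB x])
    filter_upwards [hYB] with ω hω T hT
    set D : Data n p := fun i => Z i ω with hD
    obtain ⟨f, hf, Q, hQ, hfQ⟩ := exists_treeClass_near (rep := rep) (val := val) (A := A)
      hB.le (fun v hv => exists_grid_near hB hn hv) hA hω K Set.univ T hT
    set o := output D T with ho
    have hom : Measurable o := measurable_outputFrom D T _
    have hoB : ∀ x, |o x| ≤ B := abs_outputFrom_le hB.le hω T _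
    have hQ' : (Q.card : ℝ) ≤ 2 ^ K := by exact_mod_cast (by omega : Q.card ≤ 2 ^ K)
    have hBn : 0 ≤ B / n := by positivity
    have iI : ∀ q, Integrable ((G q).indicator (1 : (Fin p → ℝ) → ℝ)) ρ.fst := fun q =>
      (integrable_const (1 : ℝ)).indicator (hGm q)
    -- Rounding is paid for twice: in the risk through the mass of the gaps, and in `emp` through
    -- their sample counts.
    have pop : W o ≤ W f + (4 * B * (B / n) + 4 * B ^ 2 * (2 ^ K * (1 / n))) := by
      have iS : Integrable (fun x => ∑ q ∈ Q, (G q).indicator (1 : (Fin p → ℝ) → ℝ) x) ρ.fst :=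
        integrable_finsetSum _ fun q _ => iI q
      have i1 := hmem f (hFm f hf) (hFB f hf)
      have i2 : Integrable (fun x => 4 * B * (B / n) +
          4 * B ^ 2 * ∑ q ∈ Q, (G q).indicator (1 : (Fin p → ℝ) → ℝ) x) ρ.fst :=
        (integrable_const _).add (iS.const_mul _)
      calc W o ≤ ∫ x, ((f x - μ x) ^ 2 + (4 * B * (B / n) +
            4 * B ^ 2 * ∑ q ∈ Q, (G q).indicator (1 : (Fin p → ℝ) → ℝ) x)) ∂ρ.fst := by
            refine integral_mono_ae (hmem o hom hoB) (i1.add i2) ?_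
            filter_upwards [hμB] with x hx
            exact sq_sub_le_sq_sub_add Q G x hBn (hoB x) (hFB f hf x) hx
              fun hq => by rw [abs_sub_comm]; exact hfQ x hq
        _ = W f + (4 * B * (B / n) + 4 * B ^ 2 * ∑ q ∈ Q, ρ.fst.real (G q)) := by
            rw [integral_add i1 i2, integral_add (integrable_const _) (iS.const_mul _),
              integral_const_mul (4 * B ^ 2), integral_finsetSum _ fun q _ => iI q]
            simp [integral_indicator_one (hGm _), hW]
        _ ≤ _ := by
            gcongr
            calc _ ≤ ∑ _q ∈ Q, (1 / n : ℝ) := Finset.sum_le_sum fun q _ => hGρ q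
              _ = Q.card * (1 / n : ℝ) := by rw [Finset.sum_const, nsmul_eq_mul]
              _ ≤ _ := by gcongr
    have emp : ∑ i, excessLoss μ f (D i) ≤
        ∑ i, excessLoss μ o (D i) + (4 * B ^ 2 + 4 * B ^ 2 * (2 ^ K * g ω)) := by
      calc ∑ i, excessLoss μ f (D i) ≤ ∑ i, (excessLoss μ o (D i) + (4 * B * (B / n) +
            4 * B ^ 2 * ∑ q ∈ Q, (G q).indicator (1 : (Fin p → ℝ) → ℝ) (D i).1)) := by
            refine Finset.sum_le_sum fun i _ => ?_
            have := sq_sub_le_sq_sub_add Q G (D i).1 hBn (hFB f hf (D i).1) (hoB (D i).1) (hω i)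
              fun hq => hfQ (D i).1 hq
            simp only [excessLoss]; linarith
        _ = ∑ i, excessLoss μ o (D i) + (4 * B ^ 2 +
            4 * B ^ 2 * ∑ q ∈ Q, ∑ i, (G' q).indicator (1 : (Fin p → ℝ) × ℝ → ℝ) (Z i ω)) := by
            rw [Finset.sum_add_distrib, Finset.sum_add_distrib, Finset.sum_comm (s := Q),
              Finset.mul_sum]
            congr 2
            simp only [Finset.sum_const, Finset.card_univ, Fintype.card_fin, nsmul_eq_mul]
            field_simp
        _ ≤ _ := by
            gcongr
            calc _ ≤ ∑ _q ∈ Q, g ω := Finset.sum_le_sum fun q _ => hgle q (Finset.mem_univ q) ω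
              _ = Q.card * g ω := by rw [Finset.sum_const, nsmul_eq_mul]
              _ ≤ _ := mul_le_mul_of_nonneg_right hQ' (hg0 ω)
    have fluct : W f ≤ 2 / n * ∑ i, excessLoss μ f (D i) + 64 * B ^ 2 / n * h ω := by
      have h1 := hhle f hf ω
      rw [← Finset.mul_sum, Finset.sum_sub_distrib] at h1
      simp only [Finset.sum_const, Finset.card_univ, Fintype.card_fin, nsmul_eq_mul] at h1
      have h2 := mul_le_mul_of_nonneg_left h1 (by positivity : 0 ≤ 64 * B ^ 2 / n)
      have e : 64 * B ^ 2 / n * (a * (n * (W f / 2) - ∑ i, excessLoss μ f (Z i ω))) =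
          W f - 2 / n * ∑ i, excessLoss μ f (D i) := by
        rw [ha]; field_simp; ring
      rw [e] at h2
      linarith
    have emp' := mul_le_mul_of_nonneg_left emp (by positivity : (0 : ℝ) ≤ 2 / n)
    calc W o ≤ 2 / n * (∑ i, excessLoss μ o (D i) + (4 * B ^ 2 + 4 * B ^ 2 * (2 ^ K * g ω))) +
          64 * B ^ 2 / n * h ω + (4 * B * (B / n) + 4 * B ^ 2 * (2 ^ K * (1 / n))) := by linarith
      _ = _ := by ring

/-! ### The oracle inequality -/

theorem expectation_le_lintegral {Ω : Type*} [MeasurableSpace Ω] {P : Measure Ω} {f h : Ω → ℝ≥0∞}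
    (hh : AEMeasurable h P) (hle : ∀ᵐ ω ∂P, f ω ≤ h ω) : expectation P f ≤ ∫⁻ ω, h ω ∂P := by
  rw [lintegral_congr_ae hh.ae_eq_mk]
  refine iInf_le_of_le (hh.mk h) (iInf_le_of_le hh.measurable_mk (iInf_le_of_le ?_ le_rfl))
  filter_upwards [hle, hh.ae_eq_mk] with ω h1 h2
  rwa [← h2]

/-- A function of bounded variation on a closed set of full measure is almost everywhere
measurable. -/
theorem aemeasurable_of_eVariationOn_ne_top {ν : Measure ℝ} {h : ℝ → ℝ} {S : Set ℝ}
    (hS : IsClosed S) (hν : ∀ᵐ x ∂ν, x ∈ S) (hh : eVariationOn h S ≠ ∞) : AEMeasurable h ν := by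
  obtain ⟨f, g, hf, hg, rfl⟩ :=
    (show BoundedVariationOn h S from hh).locallyBoundedVariationOn.exists_monotoneOn_sub_monotoneOn
  rw [← Measure.restrict_eq_self_of_ae_mem hν]
  exact (aemeasurable_restrict_of_monotoneOn hS.measurableSet hf).sub
    (aemeasurable_restrict_of_monotoneOn hS.measurableSet hg)

theorem ae_mem_coordSupport (ν : Measure (Fin p → ℝ)) :
    ∀ᵐ x ∂ν, ∀ j, x j ∈ coordSupport ν j :=
  ae_all_iff.2 fun j => ae_of_ae_map (measurable_pi_apply j).aemeasurable Measure.support_mem_ae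

theorem aemeasurable_sum_of_variation_ne_top {ν : Measure (Fin p → ℝ)} {gs : Fin p → ℝ → ℝ}
    (h : ∀ j, variation ν j (gs j) ≠ ∞) : AEMeasurable (fun x => ∑ j, gs j (x j)) ν :=
  Finset.aemeasurable_fun_sum _ fun j _ =>
    (aemeasurable_of_eVariationOn_ne_top Measure.isClosed_support Measure.support_mem_ae
      (h j)).comp_measurable (measurable_pi_apply j)

theorem normSq_sub_eq_ofReal {ν : Measure (Fin p → ℝ)} {f g : (Fin p → ℝ) → ℝ}
    (h : Integrable (fun x => (g x - f x) ^ 2) ν) :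
    normSq ν (fun x => f x - g x) = ENNReal.ofReal (∫ x, (g x - f x) ^ 2 ∂ν) := by
  rw [ofReal_integral_eq_lintegral_ofReal h (ae_of_all _ fun x => sq_nonneg _), normSq]
  refine lintegral_congr fun x => ?_
  rw [sq_abs, ← neg_sub, neg_sq]

/-- The oracle inequality for a fixed additive function of total variation at most `V`. -/
theorem expectation_normSq_le {B : ℝ} (hB : 0 < B) {n K : ℕ} (hnp : 2 ≤ n * p) (hK : 1 ≤ K)
    {ρ : Measure ((Fin p → ℝ) × ℝ)} [IsProbabilityMeasure ρ] (hY : ∀ᵐ z ∂ρ, |z.2| ≤ B)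
    {μ : (Fin p → ℝ) → ℝ} (hμ : IsRegressionFunction ρ μ)
    {Ω : Type*} [MeasurableSpace Ω] {P : Measure Ω} {Z : Fin n → Ω → (Fin p → ℝ) × ℝ}
    (hZ : ∀ i, Measurable (Z i)) (hlaw : ∀ i, P.map (Z i) = ρ) (hind : iIndepFun Z P)
    {T : Ω → Tree p} (hT : ∀ᵐ ω ∂P, IsCARTTree (fun i => Z i ω) K (T ω))
    {gs : Fin p → ℝ → ℝ} {V : ℝ} (hgs : ∀ j, variation ρ.fst j (gs j) ≠ ∞)
    (hV : ∑ j, (variation ρ.fst j (gs j)).toReal ≤ V)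
    (hL2 : Integrable (fun x => (∑ j, gs j (x j) - μ x) ^ 2) ρ.fst) :
    expectation P (fun ω => normSq ρ.fst (fun x => μ x - output (fun i => Z i ω) (T ω) x)) ≤
      ENNReal.ofReal (2 * (∫ x, (∑ j, gs j (x j) - μ x) ^ 2 ∂ρ.fst + V ^ 2 / (K + 3) +
        360 * B ^ 2 * (2 ^ K * Real.log ((n : ℝ) * p) / n))) := by
  have hP := hind.isProbabilityMeasure
  have hn : 0 < n := Nat.pos_of_ne_zero (by rintro rfl; simp at hnp)
  have hn0 : (0 : ℝ) < n := by exact_mod_cast hn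
  obtain ⟨H, hHi, hHint, hH⟩ := exists_deviation_majorant hB K hnp hY hμ hZ hlaw hind
  set g : (Fin p → ℝ) → ℝ := fun x => ∑ j, gs j (x j) with hg
  have hmem : MemLp (fun x => g x - μ x) 2 ρ.fst :=
    (memLp_two_iff_integrable_sq ((aemeasurable_sum_of_variation_ne_top hgs).sub
      hμ.1.aemeasurable).aestronglyMeasurable).2 hL2
  obtain ⟨iℓ, hℓ⟩ := hμ.integral_excessLoss hY hmem
  have iℓ' : ∀ i, Integrable (excessLoss μ g) (P.map (Z i)) := fun i => by rwa [hlaw i]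
  have iℓZ : ∀ i, Integrable (fun ω => excessLoss μ g (Z i ω)) P := fun i =>
    (integrable_map_measure (iℓ' i).aestronglyMeasurable (hZ i).aemeasurable).1 (iℓ' i)
  have hℓZ : ∀ i, ∫ ω, excessLoss μ g (Z i ω) ∂P = ∫ x, (g x - μ x) ^ 2 ∂ρ.fst := fun i => by
    rw [← hℓ, ← hlaw i, integral_map (hZ i).aemeasurable (iℓ' i).aestronglyMeasurable]
  set R : Ω → ℝ := fun ω => 2 / n * ∑ i, excessLoss μ g (Z i ω) + 2 * (V ^ 2 / (K + 3)) + H ω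
    with hR
  have iS : Integrable (fun ω => 2 / n * ∑ i, excessLoss μ g (Z i ω)) P :=
    (integrable_finsetSum _ fun i _ => iℓZ i).const_mul _
  have iR1 : Integrable (fun ω => 2 / n * ∑ i, excessLoss μ g (Z i ω) +
      2 * (V ^ 2 / ((K : ℝ) + 3))) P := iS.add (integrable_const _)
  have iR : Integrable R P := iR1.add hHi
  have hRint : ∫ ω, R ω ∂P ≤ 2 * (∫ x, (g x - μ x) ^ 2 ∂ρ.fst + V ^ 2 / (K + 3) +
      360 * B ^ 2 * (2 ^ K * Real.log ((n : ℝ) * p) / n)) := by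
    rw [hR, integral_add iR1 hHi, integral_add iS (integrable_const _), integral_const_mul,
      integral_finsetSum _ fun i _ => iℓZ i]
    simp only [hℓZ, Finset.sum_const, Finset.card_univ, Fintype.card_fin, nsmul_eq_mul,
      integral_const, probReal_univ, one_smul]
    have e : 2 / (n : ℝ) * (n * ∫ x, (g x - μ x) ^ 2 ∂ρ.fst) =
        2 * ∫ x, (g x - μ x) ^ 2 ∂ρ.fst := by field_simp
    rw [e]; linarith
  have hYB : ∀ᵐ ω ∂P, ∀ i, |(Z i ω).2| ≤ B :=
    ae_all_iff.2 fun i => ae_of_ae_map (hZ i).aemeasurable ((hlaw i).symm ▸ hY)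
  have hsuppρ : ∀ᵐ z ∂ρ, ∀ j, z.1 j ∈ coordSupport ρ.fst j :=
    ae_of_ae_map measurable_fst.aemeasurable (ae_mem_coordSupport ρ.fst)
  have hsupp : ∀ᵐ ω ∂P, ∀ i j, (Z i ω).1 j ∈ coordSupport ρ.fst j :=
    ae_all_iff.2 fun i => ae_of_ae_map (hZ i).aemeasurable (by rwa [hlaw i])
  have hμB : ∀ᵐ x ∂ρ.fst, |μ x| ≤ B :=
    (ae_map_iff measurable_fst.aemeasurable (measurableSet_le hμ.1.abs measurable_const)).2
      (hμ.ae_abs_le hY)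
  -- `R` is an integrable majorant that does not involve `T`, so measurability of the tie-breaking
  -- plays no role; it is nonnegative because it dominates a squared norm.
  have key : ∀ᵐ ω ∂P, 0 ≤ R ω ∧
      normSq ρ.fst (fun x => μ x - output (fun i => Z i ω) (T ω) x) ≤ ENNReal.ofReal (R ω) := by
    filter_upwards [hT, hH, hYB, hsupp] with ω hTω hHω hYω hSω
    set o := output (fun i => Z i ω) (T ω) with ho
    have h1 := hHω _ hTω
    have h2 := trainingError_le hSω hgs hV hK hTω
    have h3 : ∑ i, excessLoss μ o (Z i ω) ≤
        ∑ i, excessLoss μ g (Z i ω) + n * (V ^ 2 / (K + 3)) := by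
      simp only [excessLoss, Finset.sum_sub_distrib]
      have e : ∀ f : (Fin p → ℝ) → ℝ, ∑ i, (f (Z i ω).1 - (Z i ω).2) ^ 2 =
          ∑ i, ((Z i ω).2 - f (Z i ω).1) ^ 2 := fun f =>
        Finset.sum_congr rfl fun i _ => by ring
      rw [e o, e g]
      linarith
    have h4 := mul_le_mul_of_nonneg_left h3 (by positivity : (0 : ℝ) ≤ 2 / n)
    have h5 : ∫ x, (o x - μ x) ^ 2 ∂ρ.fst ≤ R ω := by
      have e : 2 / (n : ℝ) * (∑ i, excessLoss μ g (Z i ω) + n * (V ^ 2 / (K + 3))) =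
          2 / n * ∑ i, excessLoss μ g (Z i ω) + 2 * (V ^ 2 / (K + 3)) := by field_simp
      rw [e] at h4
      simp only [hR]; linarith
    have iO : Integrable (fun x => (o x - μ x) ^ 2) ρ.fst := by
      refine (MemLp.of_bound ((measurable_outputFrom _ _ _).sub hμ.1).aestronglyMeasurable
        (2 * B) ?_).integrable_sq
      filter_upwards [hμB] with x hx
      have := abs_outputFrom_le hB.le hYω (T ω) Set.univ x
      exact (abs_sub _ _).trans (by linarith)
    exact ⟨(integral_nonneg fun x => sq_nonneg _).trans h5,
      (normSq_sub_eq_ofReal iO).trans_le (ENNReal.ofReal_le_ofReal h5)⟩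
  refine (expectation_le_lintegral iR.aestronglyMeasurable.aemeasurable.ennreal_ofReal
    (key.mono fun ω h => h.2)).trans ?_
  rw [← ofReal_integral_eq_lintegral_ofReal iR (key.mono fun ω h => h.1)]
  exact ENNReal.ofReal_le_ofReal hRint

end CART

theorem mainTheorem1 (B : ℝ) (hB : 0 < B) :
    ∃ C : ℝ, 0 < C ∧
      ∀ (n p K : ℕ), 2 ≤ n * p → 1 ≤ K →
      ∀ (ρ : Measure ((Fin p → ℝ) × ℝ)) [IsProbabilityMeasure ρ],
        (∀ᵐ z ∂ρ, |z.2| ≤ B) →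
      ∀ (μ : (Fin p → ℝ) → ℝ), CART.IsRegressionFunction ρ μ →
      ∀ (Ω : Type*) [MeasurableSpace Ω] (P : Measure Ω) [IsProbabilityMeasure P]
        (Z : Fin n → Ω → (Fin p → ℝ) × ℝ),
        (∀ i, Measurable (Z i)) → (∀ i, P.map (Z i) = ρ) → iIndepFun Z P →
      ∀ (T : Ω → CART.Tree p),
        (∀ᵐ ω ∂P, CART.IsCARTTree (fun i => Z i ω) K (T ω)) →
        CART.expectation P (fun ω =>
            CART.normSq ρ.fst (fun x => μ x - CART.output (fun i => Z i ω) (T ω) x)) ≤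
          2 * ⨅ g ∈ CART.additiveBV ρ.fst,
            (CART.normSq ρ.fst (fun x => μ x - g x)
              + CART.tvNorm ρ.fst g ^ 2 / ((K : ℝ≥0∞) + 3)
              + ENNReal.ofReal (C * (2 ^ K * Real.log ((n : ℝ) * (p : ℝ)) / (n : ℝ)))) := by
  -- Half of the deviation constant `720 B²`, since the whole bound carries the factor `2`.
  refine ⟨360 * B ^ 2, by positivity, ?_⟩
  intro n p K hnp hK ρ _ hY μ hμ Ω _ P _ Z hZ hlaw hind T hT
  rw [ENNReal.mul_iInf_of_ne two_ne_zero ENNReal.ofNat_ne_top]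
  refine le_iInf fun g => ?_
  rw [ENNReal.mul_iInf_of_ne two_ne_zero ENNReal.ofNat_ne_top]
  refine le_iInf fun hg => ?_
  set E := 360 * B ^ 2 * (2 ^ K * Real.log ((n : ℝ) * (p : ℝ)) / (n : ℝ)) with hE
  have hE0 : 0 ≤ E := by
    have := CART.two_thirds_le_log hnp
    have : 0 ≤ Real.log ((n : ℝ) * p) := by linarith
    positivity
  by_cases htop : CART.normSq ρ.fst (fun x => μ x - g x) = ∞
  · simp [htop]
  set w := (CART.normSq ρ.fst (fun x => μ x - g x)).toReal with hw
  have htv : CART.tvNorm ρ.fst g ≠ ∞ := by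
    obtain ⟨gs, hgs⟩ := hg
    exact ((iInf₂_le gs hgs).trans_lt (ENNReal.sum_lt_top.2 fun j _ => hgs.1 j)).ne
  -- The infimum defining `‖g‖_TV` need not be attained; take a representation of variation below
  -- `V` for each larger `V`, then let `V` decrease to the norm.
  have hbound : ∀ V : ℝ, (CART.tvNorm ρ.fst g).toReal < V →
      CART.expectation P (fun ω =>
        CART.normSq ρ.fst (fun x => μ x - CART.output (fun i => Z i ω) (T ω) x)) ≤
      ENNReal.ofReal (2 * (w + V ^ 2 / (K + 3) + E)) := by
    intro V hV
    obtain ⟨gs, hgs⟩ := iInf_lt_iff.1 ((ENNReal.lt_ofReal_iff_toReal_lt htv).2 hV)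
    obtain ⟨hrep, hlt⟩ := iInf_lt_iff.1 hgs
    have hfin : ∀ j, CART.variation ρ.fst j (gs j) ≠ ∞ := fun j => (hrep.1 j).ne
    have hsum : ∑ j, (CART.variation ρ.fst j (gs j)).toReal ≤ V := by
      rw [← ENNReal.toReal_sum fun j _ => hfin j]
      exact ENNReal.toReal_le_of_le_ofReal (ENNReal.toReal_nonneg.trans hV.le) hlt.le
    have hnorm : CART.normSq ρ.fst (fun x => μ x - g x) =
        ∫⁻ x, ENNReal.ofReal ((∑ j, gs j (x j) - μ x) ^ 2) ∂ρ.fst := by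
      refine lintegral_congr_ae ?_
      filter_upwards [hrep.2] with x hx
      rw [sq_abs, hx, ← neg_sub, neg_sq]
    have hmeas : AEStronglyMeasurable (fun x => (∑ j, gs j (x j) - μ x) ^ 2) ρ.fst :=
      (((CART.aemeasurable_sum_of_variation_ne_top hfin).sub hμ.1.aemeasurable).pow_const
        2).aestronglyMeasurable
    have hL2 : Integrable (fun x => (∑ j, gs j (x j) - μ x) ^ 2) ρ.fst :=
      (lintegral_ofReal_ne_top_iff_integrable hmeas (ae_of_all _ fun x => sq_nonneg _)).1
        (hnorm ▸ htop)
    have hwint : w = ∫ x, (∑ j, gs j (x j) - μ x) ^ 2 ∂ρ.fst := by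
      rw [hw, hnorm, integral_eq_lintegral_of_nonneg_ae (ae_of_all _ fun x => sq_nonneg _) hmeas]
    rw [hwint]
    exact CART.expectation_normSq_le hB hnp hK hY hμ hZ hlaw hind hT hfin hsum hL2
  have hcont : Continuous fun V : ℝ => ENNReal.ofReal (2 * (w + V ^ 2 / (K + 3) + E)) :=
    ENNReal.continuous_ofReal.comp (by fun_prop)
  have hlim := ge_of_tendsto
    ((hcont.tendsto (CART.tvNorm ρ.fst g).toReal).mono_left nhdsWithin_le_nhds)
    (eventually_nhdsWithin_of_forall (s := Set.Ioi _) hbound)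
  refine hlim.trans_eq ?_
  have hw0 : 0 ≤ w := ENNReal.toReal_nonneg
  have hK3 : (0 : ℝ) < K + 3 := by positivity
  rw [ENNReal.ofReal_mul zero_le_two, ENNReal.ofReal_add (by positivity) hE0,
    ENNReal.ofReal_add hw0 (by positivity), hw, ENNReal.ofReal_toReal htop,
    ENNReal.ofReal_div_of_pos hK3, ENNReal.ofReal_pow ENNReal.toReal_nonneg,
    ENNReal.ofReal_toReal htv, ENNReal.ofReal_add (by positivity) (by norm_num)]
  simp
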